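/- Let $p\in(0,1)$, $q=1-p$, $H=-p\ln p-q\ln q$, and let $\Xi^{(1)},\Xi^{(2)},\dots$ be i.i.d. random infinite strings whose letters are i.i.d. in $\{0,1\}$ with $\mathbb P(1)=p$. Fix an integer $b\ge1$. In the $b$-trie of a finite family of strings, a node (a finite string) reached by more than $b$ of the strings (i.e. a prefix of more than $b$ of them) is internal and passes its strings to its children according to their next letter; a node reached, from the root through internal nodes, by $j$ strings with $1\le j\le b$ is a leaf storing these $j$ strings. For $1\le j\le b$ let $Z_{jn}$ be the number of leaves storing exactly $j$ strings in the $b$-trie of $\Xi^{(1)},\dots,\Xi^{(n)}$, and let $\widetilde Z_{j\lambda}$ be the same number when $n$ is replaced by a random $N_\lambda\sim\mathrm{Po}(\lambda)$ independent of the strings. Put $$f_j(x)=\mathbb P(\mathrm{Po}(px)=j)\,\mathbb P(\mathrm{Po}(qx)>b-j)+\mathbb P(\mathrm{Po}(qx)=j)\,\mathbb P(\mathrm{Po}(px)>b-j),\qquad g_j(t)=e^tf_j(e^{-t}),$$ $c_j=\int_{-\infty}^\infty g_j(t)\,dt$ and $\widehat g_j(s)=\int_{-\infty}^\infty e^{-\mathrm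 ist}g_j(t)\,dt$ for $s\in\mathbb R$. For $1\le j\le b$ the following holds. (0) The function $g_j$ is integrable, $$c_j=\int_0^\infty f_j(x)x^{-2}\,dx=\begin{cases}p\ln\frac1p+q\ln\frac1q-\sum_{k=1}^{b-1}\frac1k(pq^k+qp^k),&j=1,\\[2pt]\frac1{j(j-1)}-\sum_{k=0}^{b-j}\frac{(j+k-2)!}{j!\,k!}(p^jq^k+q^jp^k),&2\le j\le b,\end{cases}$$ and also $c_j=\sum_{k=b-j+1}^\infty\frac{(j+k-2)!}{j!\,k!}(p^jq^k+q^jp^k)$. For all real $s$, except when $(j,s)=(1,0)$, $$\widehat g_j(s)=\int_0^\infty f_j(x)x^{-2+\mathrm is}\,dx=\frac{\Gamma(j-1+\mathrm is)}{j!}\bigl(p^{1-\mathrm is}+q^{1-\mathrm is}\bigr)-\sum_{k=0}^{b-j}\frac{\Gamma(j+k-1+\mathrm is)}{j!\,k!}(p^jq^k+q^jp^k).$$ (i) If $\ln p/\ln q$ is irrational, then, as $n\to\infty$, $\mathbb E Z_{jn}/n\to\pi_j:=c_j/H$. (ii) If $\ln p/\ln q$ is rational, let $d=\gcd(\ln p,\ln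 q)$ be the largest positive real number such that $\ln p$ and $\ln q$ both are integer multiples of $d$ (it exists). Then there is a continuous $d$-periodic function $\psi_{b,j}:\mathbb R\to\mathbb R$ with mean $\frac1d\int_0^d\psi_{b,j}(t)\,dt=\pi_j:=c_j/H$ and the (absolutely convergent) Fourier expansion $$\psi_{b,j}(t)=H^{-1}\sum_{k=-\infty}^\infty\widehat g_j(-2\pi k/d)\,e^{2\pi\mathrm ikt/d}=\pi_j+H^{-1}\sum_{k\ne0}\widehat g_j(-2\pi k/d)\,e^{2\pi\mathrm ikt/d}\qquad(t\in\mathbb R),$$ such that $\mathbb E Z_{jn}/n=\psi_{b,j}(\ln n)+o(1)$ as $n\to\infty$. The same results hold in the Poisson model, with the same $\psi_{b,j}$: as $\lambda\to\infty$, $\mathbb E\widetilde Z_{j\lambda}/\lambda\to\pi_j$ in case (i), and $\mathbb E\widetilde Z_{j\lambda}/\lambda=\psi_{b,j}(\ln\lambda)+o(1)$ in case (ii). -/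

import Mathlib

open Real MeasureTheory ProbabilityTheory Filter Topology
open scoped NNReal Nat

/-! ### Tries for infinite binary strings

An infinite string is a function `ℕ → Bool` (`true` is the letter 1, `false` the letter 0);
a finite string, which is also a node of the infinite binary tree, is a `List Bool`. -/

/-- The infinite string `s` begins with the finite string `α`. -/
def BeginsWith (s : ℕ → Bool) (α : List Bool) : Prop :=
  ∀ (k : ℕ) (hk : k < α.length), s k = α[k]

open Classical in
/-- The number of strings among the first `n` strings `X 0, …, X (n - 1)` that begin with `α`. -/
noncomputable def prefixCount (X : ℕ → ℕ → Bool) (n : ℕ) (α : List Bool) : ℕ :=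
  ((Finset.range n).filter fun i => BeginsWith (X i) α).card

/-- The nodes of the `b`-trie built from `X 0, …, X (n - 1)`, generated from the root:
if there is at least one string, the root is a node; a node reached by more than `b` strings is
internal, and passes its strings on to its children according to their next letter;
a child is present if it receives at least one string. -/
inductive BTrieNode (b : ℕ) (X : ℕ → ℕ → Bool) (n : ℕ) : List Bool → Prop
  | root : 0 < n → BTrieNode b X n []
  | child (α : List Bool) (a : Bool) : BTrieNode b X n α → b < prefixCount X n α →
      0 < prefixCount X n (α ++ [a]) → BTrieNode b X n (α ++ [a])

/-- `α` is an external node (leaf) of the `b`-trie: a node reached by at most `b` strings,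
all of which are stored there. -/
def IsBTrieLeaf (b : ℕ) (X : ℕ → ℕ → Bool) (n : ℕ) (α : List Bool) : Prop :=
  BTrieNode b X n α ∧ prefixCount X n α ≤ b

/-- The number of leaves of the `b`-trie built from `X 0, …, X (n - 1)` that store exactly `j`
strings. -/
noncomputable def leafCount (b j : ℕ) (X : ℕ → ℕ → Bool) (n : ℕ) : ℕ :=
  {α : List Bool | IsBTrieLeaf b X n α ∧ prefixCount X n α = j}.ncard

/-! ### Random strings -/

/-- `Ξ 0, Ξ 1, …` are i.i.d. random infinite strings whose letters are i.i.d. and equal to 1 with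
probability `p`. -/
structure IsBernoulliStrings {Ω : Type*} [MeasurableSpace Ω] (μ : Measure Ω) (p : ℝ)
    (Ξ : ℕ → Ω → ℕ → Bool) : Prop where
  measurable_letter : ∀ i k, Measurable fun ω => Ξ i ω k
  prob_one : ∀ i k, μ.real {ω | Ξ i ω k = true} = p
  indep : iIndepFun (fun (ik : ℕ × ℕ) (ω : Ω) => Ξ ik.1 ω ik.2) μ

/-- For every `l ≥ 0`, `N l` is a Poisson random variable with mean `l`, independent of the
strings. -/
structure IsPoissonNumber {Ω : Type*} [MeasurableSpace Ω] (μ : Measure Ω)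
    (Ξ : ℕ → Ω → ℕ → Bool) (N : ℝ≥0 → Ω → ℕ) : Prop where
  law : ∀ l, HasLaw (N l) (poissonMeasure l) μ
  indep : ∀ l, IndepFun (N l) (fun ω i => Ξ i ω) μ

/-- `E Z_{jn}`: the expected number of leaves storing exactly `j` strings in the `b`-trie built
from `n` strings. -/
noncomputable def expectedLeaves {Ω : Type*} [MeasurableSpace Ω] (μ : Measure Ω)
    (Ξ : ℕ → Ω → ℕ → Bool) (b j n : ℕ) : ℝ :=
  ∫ ω, (leafCount b j (fun i => Ξ i ω) n : ℝ) ∂μ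

/-- The same expectation for a `b`-trie built from a random number `M` of strings. -/
noncomputable def expectedLeavesRandom {Ω : Type*} [MeasurableSpace Ω] (μ : Measure Ω)
    (Ξ : ℕ → Ω → ℕ → Bool) (b j : ℕ) (M : Ω → ℕ) : ℝ :=
  ∫ ω, (leafCount b j (fun i => Ξ i ω) (M ω) : ℝ) ∂μ

/-! ### The constants; everywhere `q = 1 - p` -/

/-- The entropy `H` of a letter. -/
noncomputable def letterEntropy (p q : ℝ) : ℝ := -p * log p - q * log q

/-- `P(Po(x) = k)`. -/
noncomputable def poissonProb (x : ℝ) (k : ℕ) : ℝ := exp (-x) * x ^ k / k !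

/-- `f_j(x) = P(Po(px) = j) P(Po(qx) > b - j) + P(Po(qx) = j) P(Po(px) > b - j)`. -/
noncomputable def fLeaf (p q : ℝ) (b j : ℕ) (x : ℝ) : ℝ :=
  poissonProb (p * x) j * (1 - ∑ k ∈ Finset.range (b - j + 1), poissonProb (q * x) k) +
    poissonProb (q * x) j * (1 - ∑ k ∈ Finset.range (b - j + 1), poissonProb (p * x) k)

/-- `g_j(t) = e^t f_j(e^{-t})`. -/
noncomputable def gLeaf (p q : ℝ) (b j : ℕ) (t : ℝ) : ℝ := exp t * fLeaf p q b j (exp (-t))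

/-- `c_j = ∫ g_j(t) dt`. -/
noncomputable def cLeaf (p q : ℝ) (b j : ℕ) : ℝ := ∫ t : ℝ, gLeaf p q b j t

/-- The Fourier transform `ĝ_j(s) = ∫ e^{-ist} g_j(t) dt`. -/
noncomputable def gHatLeaf (p q : ℝ) (b j : ℕ) (s : ℝ) : ℂ :=
  ∫ t : ℝ, Complex.exp (-Complex.I * s * t) * (gLeaf p q b j t : ℂ)

/-- The common term `(j + k - 2)! / (j! k!) * (p^j q^k + q^j p^k)` of the formulas for `c_j`,
used only for `j + k ≥ 2`. -/
noncomputable def cTerm (p q : ℝ) (j k : ℕ) : ℝ :=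
  ((j + k - 2)! : ℝ) / ((j ! : ℝ) * (k ! : ℝ)) * (p ^ j * q ^ k + q ^ j * p ^ k)

/-- The explicit formula for `ĝ_j(s)` in terms of the Gamma function. -/
noncomputable def gHatGamma (p q : ℝ) (b j : ℕ) (s : ℝ) : ℂ :=
  Complex.Gamma ((j : ℂ) - 1 + Complex.I * s) / (j ! : ℂ) *
      ((p : ℂ) ^ (1 - Complex.I * s) + (q : ℂ) ^ (1 - Complex.I * s)) -
    ∑ k ∈ Finset.range (b - j + 1),
      Complex.Gamma ((j : ℂ) + k - 1 + Complex.I * s) / ((j ! : ℂ) * (k ! : ℂ)) *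
        ((p : ℂ) ^ j * (q : ℂ) ^ k + (q : ℂ) ^ j * (p : ℂ) ^ k)

/-- The positive reals `d` such that `ln p` and `ln q` are integer multiples of `d`;
`gcd(ln p, ln q)` is the largest of them. -/
def commonLogDivisors (p q : ℝ) : Set ℝ :=
  {d : ℝ | 0 < d ∧ (∃ m : ℤ, log p = m * d) ∧ ∃ m : ℤ, log q = m * d}

/-! ### Combinatorics of tries -/

/-! With a Po(x) number of strings, the numbers of strings reaching two sibling nodes are
independent Poisson variables. A child of a word β is a leaf storing j strings exactly when it
receives j strings and its sibling more than b - j. Summing over both children, the expected number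
of leaves other than the root is F(x) = Σ_β f_j(x P(β)), over all finite words β. Splitting β at its
first letter gives F(x) = f_j(x) + F(px) + F(qx). Hence h(t) = e^{-t} F(e^t) solves the renewal
equation h = z + p h(· - A) + q h(· - B), with A = -ln p, B = -ln q, z(t) = g_j(-t) and mean step pA
+ qB = H.

The renewal theorem is proved directly for this two-point step. An extremal argument at the limsup
shows that h(t) - h(t - A) → 0, and likewise for B (`RenewalSolution.tendsto_diff`), so A and B lie
in the group of asymptotic periods of h. If A/B is irrational, this group is dense, and it is closed
because h is Lipschitz, so every real is an asymptotic period. The quantity p ∫_{T-A}^T h + q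
∫_{T-B}^T h has derivative z and vanishes at -∞; it therefore tends to ∫ z = c_j, while it is
asymptotic to H h(T) (`tendsto_of_irrational`). In the lattice case the same argument with sums over
the lattice of step d replaces ∫ z by d Σ_k z(t + kd) (`tendsto_of_lattice`), and Poisson summation
turns this into the stated Fourier series (`hasSum_leafPeriodic`).

To return to a fixed number n of strings, one uses that a new string changes the number of leaves by
at most 2. The expectations thus have bounded increments, and their Poisson transform at n differs
from the n-th term by O(√n) (`abs_poissonTransform_nat_sub_le`). The same increment bound makes h
Lipschitz.

The formulas for the transform of g_j come from the substitution x = e^{-t}, which gives a Mellin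
transform of f_j on the line Re = -1. Just to the right of that line f_j splits into Gamma
integrals, and both sides extend continuously to the line; for j = 1, s = 0 the pole of Γ cancels
against p + q = 1. -/

theorem BeginsWith.of_prefix {s : ℕ → Bool} {α γ : List Bool} (h : BeginsWith s γ)
    (hα : α <+: γ) : BeginsWith s α := by
  obtain ⟨δ, rfl⟩ := hα
  intro k hk
  rw [h k (by simp; omega), List.getElem_append_left hk]

theorem beginsWith_nil (s : ℕ → Bool) : BeginsWith s [] := fun _ hk => by simp at hk

theorem beginsWith_concat {s : ℕ → Bool} {α : List Bool} {a : Bool} :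
    BeginsWith s (α ++ [a]) ↔ BeginsWith s α ∧ s α.length = a := by
  constructor
  · intro h
    refine ⟨h.of_prefix (List.prefix_append _ _), ?_⟩
    rw [h α.length (by simp)]
    simp
  · rintro ⟨h, ha⟩ k hk
    rcases lt_or_ge k α.length with hk' | hk'
    · rw [h k hk', List.getElem_append_left hk']
    · have : k = α.length := by simp at hk; omega
      subst this
      simpa using ha

theorem BeginsWith.prefix_of_length_le {s : ℕ → Bool} {α γ : List Bool} (hα : BeginsWith s α)
    (hγ : BeginsWith s γ) (h : α.length ≤ γ.length) : α <+: γ := by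
  rw [List.prefix_iff_eq_take]
  apply List.ext_getElem
  · simp [h]
  · intro k h1 h2
    rw [List.getElem_take, ← hα k h1, hγ k]

section

variable {b j n : ℕ} {X : ℕ → ℕ → Bool} {α γ : List Bool} {a : Bool}

theorem prefixCount_anti (h : α <+: γ) : prefixCount X n γ ≤ prefixCount X n α := by
  classical
  exact Finset.card_le_card fun i hi => by
    simp only [Finset.mem_filter] at hi ⊢
    exact ⟨hi.1, hi.2.of_prefix h⟩

theorem prefixCount_concat_le : prefixCount X n (α ++ [a]) ≤ prefixCount X n α :=
  prefixCount_anti (List.prefix_append _ _)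

theorem prefixCount_nil : prefixCount X n [] = n := by
  classical
  simp [prefixCount, beginsWith_nil]

open Classical in
theorem prefixCount_succ : prefixCount X (n + 1) α =
    prefixCount X n α + if BeginsWith (X n) α then 1 else 0 := by
  unfold prefixCount
  rw [Finset.range_add_one, Finset.filter_insert]
  split_ifs with h
  · rw [Finset.card_insert_of_notMem (by simp)]
  · simp

theorem prefixCount_split (a : Bool) : prefixCount X n α =
    prefixCount X n (α ++ [a]) + prefixCount X n (α ++ [!a]) := by
  classical
  unfold prefixCount
  rw [← Finset.card_union_of_disjoint]
  · congr 1
    ext i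
    simp only [Finset.mem_filter, Finset.mem_union, beginsWith_concat]
    rcases h : X i α.length <;> cases a <;> simp
  · rw [Finset.disjoint_filter]
    intro i _ h1 h2
    rw [beginsWith_concat] at h1 h2
    have := h1.2.symm.trans h2.2
    cases a <;> simp at this

theorem prefixCount_pos_iff : 0 < prefixCount X n α ↔ ∃ i < n, BeginsWith (X i) α := by
  classical
  unfold prefixCount
  rw [Finset.card_pos]
  constructor
  · rintro ⟨i, hi⟩
    rw [Finset.mem_filter, Finset.mem_range] at hi
    exact ⟨i, hi⟩
  · rintro ⟨i, hi⟩
    exact ⟨i, by simpa using hi⟩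

/-- Counts decrease along prefixes, so every ancestor of a node with more than b strings is internal
as well. Being a leaf is thereby reduced to a condition on the counts of the node and its parent,
with no reference to the path from the root. -/
theorem bTrieNode_of_lt (h : b < prefixCount X n α) : BTrieNode b X n α := by
  induction α using List.reverseRecOn with
  | nil => rw [prefixCount_nil] at h; exact .root (by omega)
  | append_singleton α a ih =>
    have := h.trans_le prefixCount_concat_le
    exact .child α a (ih this) this (by omega)

/-- The leaves of the `b`-trie that store exactly `j` strings. -/
def leafSet (b j : ℕ) (X : ℕ → ℕ → Bool) (n : ℕ) : Set (List Bool) :=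
  {α | IsBTrieLeaf b X n α ∧ prefixCount X n α = j}

theorem leafCount_eq_ncard : leafCount b j X n = (leafSet b j X n).ncard := rfl

theorem nil_mem_leafSet_iff (hj : 1 ≤ j) (hjb : j ≤ b) : [] ∈ leafSet b j X n ↔ n = j := by
  simp only [leafSet, IsBTrieLeaf, Set.mem_ofPred_eq, prefixCount_nil]
  constructor
  · exact fun h => h.2
  · rintro rfl
    exact ⟨⟨.root (by omega), hjb⟩, rfl⟩

theorem concat_mem_leafSet_iff (hj : 1 ≤ j) (hjb : j ≤ b) : α ++ [a] ∈ leafSet b j X n ↔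
    b < prefixCount X n α ∧ prefixCount X n (α ++ [a]) = j := by
  simp only [leafSet, IsBTrieLeaf, Set.mem_ofPred_eq]
  constructor
  · rintro ⟨⟨h1, -⟩, h⟩
    refine ⟨?_, h⟩
    generalize hγ : α ++ [a] = γ at h1
    cases h1 with
    | root => simp at hγ
    | child α' a' _ h' _ =>
      obtain ⟨rfl, -⟩ := List.append_inj' hγ rfl
      exact h'
  · rintro ⟨h1, h2⟩
    exact ⟨⟨.child α a (bTrieNode_of_lt h1) h1 (by omega), by omega⟩, h2⟩

/-- Two prefixes of one string are comparable. If one were strictly shorter, it would be a prefix of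
the other's parent, and a node with at most b strings would lie above a node with more than b. The
two nodes need not be nonempty or store j strings, which is what `leafCount_succ_le` needs for
siblings of leaves. -/
theorem leaf_unique {s : ℕ → Bool} {a' : Bool} (h1 : BeginsWith s (α ++ [a]))
    (h2 : BeginsWith s (γ ++ [a'])) (h3 : b < prefixCount X n α) (h4 : b < prefixCount X n γ)
    (h5 : prefixCount X n (α ++ [a]) ≤ b) (h6 : prefixCount X n (γ ++ [a']) ≤ b) :
    α ++ [a] = γ ++ [a'] := by
  wlog hle : (α ++ [a]).length ≤ (γ ++ [a']).length generalizing α γ a a'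
  · exact (this h2 h1 h4 h3 h6 h5 (le_of_not_ge hle)).symm
  have hpre := h1.prefix_of_length_le h2 hle
  rcases hle.eq_or_lt with heq | hlt
  · exact hpre.eq_of_length heq
  · have : α ++ [a] <+: γ :=
      h1.prefix_of_length_le (h2.of_prefix (List.prefix_append _ _)) (by simp at hlt ⊢; omega)
    have := prefixCount_anti (X := X) (n := n) this
    omega

theorem leafSet_unique {s : ℕ → Bool} (hj : 1 ≤ j) (hjb : j ≤ b) (hα : α ∈ leafSet b j X n)
    (hγ : γ ∈ leafSet b j X n) (h1 : BeginsWith s α) (h2 : BeginsWith s γ) : α = γ := by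
  rcases List.eq_nil_or_concat' α with rfl | ⟨α, a, rfl⟩ <;>
    rcases List.eq_nil_or_concat' γ with rfl | ⟨γ, a', rfl⟩
  · rfl
  · rw [nil_mem_leafSet_iff hj hjb] at hα
    rw [concat_mem_leafSet_iff hj hjb] at hγ
    have := prefixCount_anti (X := X) (n := n) (List.nil_prefix (l := γ))
    rw [prefixCount_nil] at this
    omega
  · rw [nil_mem_leafSet_iff hj hjb] at hγ
    rw [concat_mem_leafSet_iff hj hjb] at hα
    have := prefixCount_anti (X := X) (n := n) (List.nil_prefix (l := α))
    rw [prefixCount_nil] at this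
    omega
  · rw [concat_mem_leafSet_iff hj hjb] at hα hγ
    exact leaf_unique h1 h2 hα.1 hγ.1 (by omega) (by omega)

theorem leafSet_finite_and_ncard_le (hj : 1 ≤ j) (hjb : j ≤ b) :
    (leafSet b j X n).Finite ∧ (leafSet b j X n).ncard ≤ n := by
  classical
  have key : ∀ α ∈ leafSet b j X n, ∃ i < n, BeginsWith (X i) α := fun α hα =>
    prefixCount_pos_iff.1 (by have := hα.2; omega)
  choose! f hf hf' using key
  have hinj : Set.InjOn f (leafSet b j X n) := fun α hα γ hγ h =>
    leafSet_unique hj hjb hα hγ (hf' α hα) (h ▸ hf' γ hγ)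
  have hmaps : Set.MapsTo f (leafSet b j X n) (Finset.range n : Set ℕ) := fun α hα => by
    simpa using hf α hα
  refine ⟨Set.Finite.of_injOn hmaps hinj (Finset.finite_toSet _), ?_⟩
  simpa using Set.ncard_le_ncard_of_injOn f hmaps hinj

theorem leafSet_finite (hj : 1 ≤ j) (hjb : j ≤ b) : (leafSet b j X n).Finite :=
  (leafSet_finite_and_ncard_le hj hjb).1

theorem leafCount_le (hj : 1 ≤ j) (hjb : j ≤ b) : leafCount b j X n ≤ n :=
  (leafSet_finite_and_ncard_le hj hjb).2

theorem Set.Subsingleton.ncard_le_one {β : Type*} {s : Set β} (hs : s.Subsingleton) :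
    s.ncard ≤ 1 :=
  (Set.ncard_le_one hs.finite).2 fun _ ha _ hb => hs ha hb

theorem leafSet_inter_subsingleton (s : ℕ → Bool) (hj : 1 ≤ j) (hjb : j ≤ b) :
    (leafSet b j X n ∩ {α | BeginsWith s α}).Subsingleton :=
  fun _ hα _ hγ => leafSet_unique hj hjb hα.1 hγ.1 hα.2 hγ.2

/-- A leaf gained by adding a string either is a prefix of the new string, which happens at most
once, or has an unchanged count and a parent that has just exceeded b. In the latter case the new
string goes through the parent to the sibling, and this happens at most once too. -/
theorem leafCount_succ_le (hj : 1 ≤ j) (hjb : j ≤ b) :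
    leafCount b j X (n + 1) ≤ leafCount b j X n + 2 := by
  classical
  set U := leafSet b j X (n + 1) ∩ {α | BeginsWith (X n) α} with hU
  set V := {α | α ∈ leafSet b j X (n + 1) ∧ α ∉ leafSet b j X n ∧ ¬ BeginsWith (X n) α} with hV
  have hVs : V.Subsingleton := by
    -- The parent β now holds exactly b + 1 strings and α at least one of them (j ≥ 1), so the
    -- sibling holds at most b. The sibling is then a prefix of the new string to which
    -- `leaf_unique` applies.
    have key : ∀ α ∈ V, ∃ β a, α = β ++ [a] ∧ b < prefixCount X (n + 1) β ∧
        BeginsWith (X n) (β ++ [!a]) ∧ prefixCount X (n + 1) (β ++ [!a]) ≤ b := by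
      rintro α ⟨h1, h2, h3⟩
      rcases List.eq_nil_or_concat' α with rfl | ⟨β, a, rfl⟩
      · exact absurd (beginsWith_nil _) h3
      rw [concat_mem_leafSet_iff hj hjb] at h1 h2
      have e1 := prefixCount_succ (X := X) (n := n) (α := β ++ [a])
      have e2 := prefixCount_succ (X := X) (n := n) (α := β)
      have e3 := prefixCount_split (X := X) (n := n + 1) (α := β) a
      rw [if_neg h3] at e1
      by_cases h4 : BeginsWith (X n) β
      · rw [if_pos h4] at e2
        refine ⟨β, a, rfl, h1.1, beginsWith_concat.2 ⟨h4, ?_⟩, ?_⟩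
        · rw [beginsWith_concat] at h3
          have : X n β.length ≠ a := fun h => h3 ⟨h4, h⟩
          cases a <;> simpa using this
        · have : ¬ b < prefixCount X n β := fun h => h2 ⟨h, by omega⟩
          omega
      · rw [if_neg h4] at e2
        exact absurd ⟨by omega, by omega⟩ h2
    intro α hα γ hγ
    obtain ⟨β, a, rfl, h1, h2, h3⟩ := key α hα
    obtain ⟨β', a', rfl, h1', h2', h3'⟩ := key γ hγ
    have := leaf_unique h2 h2' h1 h1' h3 h3'
    obtain ⟨rfl, h⟩ := List.append_inj' this rfl
    simp only [List.cons.injEq, and_true] at h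
    simp_all
  have hsub : leafSet b j X (n + 1) ⊆ leafSet b j X n ∪ (U ∪ V) := by
    intro α hα
    by_cases h1 : α ∈ leafSet b j X n
    · exact Or.inl h1
    · by_cases h2 : BeginsWith (X n) α
      · exact Or.inr (Or.inl ⟨hα, h2⟩)
      · exact Or.inr (Or.inr ⟨hα, h1, h2⟩)
  have hUs : U.Subsingleton := leafSet_inter_subsingleton _ hj hjb
  calc leafCount b j X (n + 1) ≤ (leafSet b j X n ∪ (U ∪ V)).ncard :=
        Set.ncard_le_ncard hsub ((leafSet_finite hj hjb).union (hUs.finite.union hVs.finite))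
    _ ≤ leafCount b j X n + (U.ncard + V.ncard) :=
        (Set.ncard_union_le _ _).trans (Nat.add_le_add_left (Set.ncard_union_le _ _) _)
    _ ≤ _ := by
        have := hUs.ncard_le_one
        have := hVs.ncard_le_one
        omega

theorem leafCount_le_succ (hj : 1 ≤ j) (hjb : j ≤ b) :
    leafCount b j X n ≤ leafCount b j X (n + 1) + 1 := by
  classical
  set U := leafSet b j X n ∩ {α | BeginsWith (X n) α} with hU
  have hUs : U.Subsingleton := leafSet_inter_subsingleton _ hj hjb
  have hsub : leafSet b j X n ⊆ leafSet b j X (n + 1) ∪ U := by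
    intro α hα
    by_cases h2 : BeginsWith (X n) α
    · exact Or.inr ⟨hα, h2⟩
    left
    rcases List.eq_nil_or_concat' α with rfl | ⟨β, a, rfl⟩
    · exact absurd (beginsWith_nil _) h2
    rw [concat_mem_leafSet_iff hj hjb] at hα ⊢
    have e1 := prefixCount_succ (X := X) (n := n) (α := β ++ [a])
    have e2 := prefixCount_succ (X := X) (n := n) (α := β)
    rw [if_neg h2] at e1
    omega
  calc leafCount b j X n ≤ (leafSet b j X (n + 1) ∪ U).ncard :=
        Set.ncard_le_ncard hsub ((leafSet_finite hj hjb).union hUs.finite)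
    _ ≤ leafCount b j X (n + 1) + U.ncard := Set.ncard_union_le _ _
    _ ≤ _ := by
        have := hUs.ncard_le_one
        omega

theorem abs_leafCount_succ_sub_le (hj : 1 ≤ j) (hjb : j ≤ b) :
    |(leafCount b j X (n + 1) : ℝ) - leafCount b j X n| ≤ 2 := by
  have h1 := leafCount_succ_le (X := X) (n := n) hj hjb
  have h2 := leafCount_le_succ (X := X) (n := n) hj hjb
  rify at h1 h2
  rw [abs_le]
  constructor <;> linarith

end

/-! ### Measurability, and the number of leaves as a sum over nodes -/

theorem measurableSet_beginsWith (α : List Bool) : MeasurableSet {s | BeginsWith s α} := by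
  have : {s | BeginsWith s α} = ⋂ (k : ℕ) (hk : k < α.length), {s : ℕ → Bool | s k = α[k]} := by
    ext s; simp [BeginsWith]
  rw [this]
  exact MeasurableSet.iInter fun k => MeasurableSet.iInter fun hk =>
    measurableSet_eq_fun (measurable_pi_apply k) measurable_const

/-- The number of strings among `X 0, …, X (n - 1)` that belong to `U`. -/
noncomputable def hitCount (U : Set (ℕ → Bool)) (X : ℕ → ℕ → Bool) (n : ℕ) : ℕ :=
  open Classical in ((Finset.range n).filter fun i => X i ∈ U).card

theorem prefixCount_eq_hitCount (X : ℕ → ℕ → Bool) (n : ℕ) (α : List Bool) :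
    prefixCount X n α = hitCount {s | BeginsWith s α} X n := by
  classical
  unfold prefixCount hitCount
  congr

open Classical in
theorem hitCount_succ (U : Set (ℕ → Bool)) (X : ℕ → ℕ → Bool) (n : ℕ) :
    hitCount U X (n + 1) = hitCount U X n + if X n ∈ U then 1 else 0 := by
  unfold hitCount
  rw [Finset.range_add_one, Finset.filter_insert]
  split_ifs with h
  · rw [Finset.card_insert_of_notMem (by simp)]
  · simp

theorem hitCount_empty (X : ℕ → ℕ → Bool) (n : ℕ) : hitCount ∅ X n = 0 := by
  simp [hitCount]

theorem measurable_hitCount {U : Set (ℕ → Bool)} (hU : MeasurableSet U) (n : ℕ) :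
    Measurable fun X => hitCount U X n := by
  classical
  induction n with
  | zero => simp [hitCount]
  | succ n ih =>
    simp only [hitCount_succ]
    exact ih.add (Measurable.ite (measurable_pi_apply n hU) measurable_const measurable_const)

theorem measurable_prefixCount (n : ℕ) (α : List Bool) :
    Measurable fun X => prefixCount X n α := by
  simp only [prefixCount_eq_hitCount]
  exact measurable_hitCount (measurableSet_beginsWith α) n

theorem measurableSet_mem_leafSet {b j : ℕ} (hj : 1 ≤ j) (hjb : j ≤ b) (n : ℕ) (α : List Bool) :
    MeasurableSet {X | α ∈ leafSet b j X n} := by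
  rcases List.eq_nil_or_concat' α with rfl | ⟨β, a, rfl⟩
  · simp only [nil_mem_leafSet_iff hj hjb]
    exact MeasurableSet.const _
  · simp only [concat_mem_leafSet_iff hj hjb]
    exact (measurableSet_lt measurable_const (measurable_prefixCount n β)).inter
      (measurableSet_eq_fun (measurable_prefixCount n (β ++ [a])) measurable_const)

theorem leafCount_eq_tsum {b j : ℕ} (hj : 1 ≤ j) (hjb : j ≤ b) (X : ℕ → ℕ → Bool) (n : ℕ) :
    (leafCount b j X n : ENNReal) =
      ∑' α : List Bool, {X | α ∈ leafSet b j X n}.indicator 1 X := by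
  classical
  have hfin := leafSet_finite (X := X) (n := n) hj hjb
  rw [tsum_eq_sum (s := hfin.toFinset), leafCount_eq_ncard, Set.ncard_eq_toFinset_card _ hfin,
    Finset.card_eq_sum_ones, Nat.cast_sum]
  · refine Finset.sum_congr rfl fun α hα => ?_
    rw [Set.indicator_of_mem]
    · simp
    · simpa using hα
  · intro α hα
    rw [Set.indicator_of_notMem]
    simpa using hα

theorem measurable_leafCount {b j : ℕ} (hj : 1 ≤ j) (hjb : j ≤ b) (n : ℕ) :
    Measurable fun X => (leafCount b j X n : ENNReal) := by
  simp only [leafCount_eq_tsum hj hjb]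
  exact Measurable.tsum fun α =>
    measurable_one.indicator (measurableSet_mem_leafSet hj hjb n α)

/-- Used in two ways: splitting off the last letter groups leaves under their parent, and splitting
off the first letter yields the renewal equation. -/
theorem tsum_list_split {ι : Type*} {c : ι → List Bool} (hc : Function.Injective c)
    (hr : ∀ α, α ≠ [] ↔ ∃ x, c x = α) (f : List Bool → ENNReal) :
    ∑' α, f α = f [] + ∑' x, f (c x) := by
  classical
  rw [ENNReal.tsum_eq_add_tsum_ite []]
  congr 1
  rw [← hc.tsum_eq]
  · refine tsum_congr fun x => ?_
    rw [if_neg ((hr _).2 ⟨x, rfl⟩)]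
  · intro α hα
    rw [Function.mem_support] at hα
    exact (hr α).1 fun h => hα (by simp [h])

theorem tsum_list_concat (f : List Bool → ENNReal) :
    ∑' α, f α = f [] + ∑' β, (f (β ++ [true]) + f (β ++ [false])) := by
  rw [tsum_list_split (c := fun x : List Bool × Bool => x.1 ++ [x.2]), ENNReal.tsum_prod']
  · simp
  · rintro ⟨β, a⟩ ⟨γ, a'⟩ h
    obtain ⟨rfl, h⟩ := List.append_inj' h rfl
    simpa using h
  · intro α
    rcases List.eq_nil_or_concat' α with rfl | ⟨β, a, rfl⟩
    · simp
    · simp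

theorem tsum_list_cons (f : List Bool → ENNReal) :
    ∑' α, f α = f [] + (∑' β, f (true :: β) + ∑' β, f (false :: β)) := by
  rw [tsum_list_split (c := fun x : Bool × List Bool => x.1 :: x.2), ENNReal.tsum_prod']
  · simp
  · rintro ⟨β, a⟩ ⟨γ, a'⟩ h
    simpa using h
  · rintro (_ | ⟨a, α⟩) <;> simp

/-! ### The multinomial law of the number of strings in two disjoint sets -/

/-- The probability that, of `n` independent trials with three outcomes of probabilities
`A`, `B`, `C`, exactly `j` have the first outcome and `i` the second. -/
noncomputable def trinomialProb (A B C : ℝ) (n j i : ℕ) : ℝ :=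
  n.choose (j + i) * (j + i).choose j * A ^ j * B ^ i * C ^ (n - (j + i))

/-- Truncated subtraction breaks the exponent identity only for n ≤ s, where the binomial
coefficient vanishes. -/
theorem choose_mul_pow_succ (C : ℝ) (n s : ℕ) :
    (n.choose (s + 1) : ℝ) * C ^ (n - s) = n.choose (s + 1) * (C * C ^ (n - (s + 1))) := by
  rcases lt_or_ge n (s + 1) with h | h
  · simp [Nat.choose_eq_zero_of_lt h]
  · rw [← pow_succ', show n - (s + 1) + 1 = n - s by omega]

theorem trinomialProb_succ_zero_zero (A B C : ℝ) (n : ℕ) :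
    trinomialProb A B C (n + 1) 0 0 = C * trinomialProb A B C n 0 0 := by
  simp [trinomialProb, pow_succ']

theorem trinomialProb_succ_succ_zero (A B C : ℝ) (n j : ℕ) :
    trinomialProb A B C (n + 1) (j + 1) 0 =
      A * trinomialProb A B C n j 0 + C * trinomialProb A B C n (j + 1) 0 := by
  have h := choose_mul_pow_succ C n j
  simp only [trinomialProb, add_zero, Nat.choose_self, Nat.choose_succ_succ n j,
    Nat.add_sub_add_right, pow_zero, Nat.cast_add, Nat.cast_one, pow_succ A]
  linear_combination A ^ j * A * h

theorem trinomialProb_succ_zero_succ (A B C : ℝ) (n i : ℕ) :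
    trinomialProb A B C (n + 1) 0 (i + 1) =
      B * trinomialProb A B C n 0 i + C * trinomialProb A B C n 0 (i + 1) := by
  have h := choose_mul_pow_succ C n i
  simp only [trinomialProb, zero_add, Nat.choose_zero_right, Nat.choose_succ_succ n i,
    Nat.add_sub_add_right, pow_zero, Nat.cast_add, Nat.cast_one, pow_succ B]
  linear_combination B ^ i * B * h

theorem trinomialProb_succ_succ_succ (A B C : ℝ) (n j i : ℕ) :
    trinomialProb A B C (n + 1) (j + 1) (i + 1) =
      A * trinomialProb A B C n j (i + 1) + B * trinomialProb A B C n (j + 1) i +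
        C * trinomialProb A B C n (j + 1) (i + 1) := by
  have h := choose_mul_pow_succ C n (j + 1 + i)
  have h1 : j + (i + 1) = j + 1 + i := by omega
  have h2 : ((j + 1 + i + 1).choose (j + 1) : ℝ) =
      (j + 1 + i).choose j + (j + 1 + i).choose (j + 1) := by
    rw [Nat.choose_succ_succ]; push_cast; ring
  simp only [trinomialProb, h1, ← add_assoc (j + 1) i 1, h2, Nat.choose_succ_succ n (j + 1 + i),
    Nat.add_sub_add_right, Nat.cast_add, pow_succ A, pow_succ B]
  linear_combination A ^ j * A * B ^ i * B *
    (((j + 1 + i).choose j : ℝ) + (j + 1 + i).choose (j + 1)) * h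

theorem HasSum.congr_eq {f g : ℕ → ℝ} {a : ℝ} (hg : HasSum g a) (h : ∀ n, f n = g n) :
    HasSum f a := by
  rwa [funext h]

/-- Poisson thinning, as a power series identity without sign conditions: the terms with n < j + i
vanish, and the shifted series is that of exp(xC), where exp(-x) exp(xC) = exp(-xA) exp(-xB). -/
theorem hasSum_poissonProb_mul_trinomialProb {A B C : ℝ} (h : A + B + C = 1) (x : ℝ) (j i : ℕ) :
    HasSum (fun n => poissonProb x n * trinomialProb A B C n j i)
      (poissonProb (x * A) j * poissonProb (x * B) i) := by
  rw [← hasSum_nat_add_iff' (j + i), Finset.sum_eq_zero, sub_zero]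
  · have h1 : HasSum (fun n : ℕ => (x * C) ^ n / n !) (exp (x * C)) := by
      rw [Real.exp_eq_exp_ℝ]; exact NormedSpace.expSeries_div_hasSum_exp _
    have h2 := h1.mul_left (exp (-x) * x ^ (j + i) * A ^ j * B ^ i / (j ! * i !))
    have e3 : exp (-x) * exp (x * C) = exp (-(x * A)) * exp (-(x * B)) := by
      rw [← exp_add, ← exp_add]
      congr 1
      linear_combination x * h
    have e4 : poissonProb (x * A) j * poissonProb (x * B) i =
        exp (-x) * x ^ (j + i) * A ^ j * B ^ i / (j ! * i !) * exp (x * C) := by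
      simp only [poissonProb, mul_pow, pow_add]
      field_simp
      linear_combination -(x ^ j * x ^ i * A ^ j * B ^ i) * e3
    rw [e4]
    refine h2.congr_eq fun n => ?_
    have e1 : ((n + (j + i)).choose (j + i) : ℝ) = (n + (j + i))! / (n ! * (j + i)!) := by
      rw [Nat.cast_choose ℝ (by omega), Nat.add_sub_cancel, mul_comm (n ! : ℝ)]
    have e2 : ((j + i).choose j : ℝ) = (j + i)! / (j ! * i !) := by
      rw [Nat.cast_choose ℝ (by omega), Nat.add_sub_cancel_left]
    simp only [poissonProb, trinomialProb, e1, e2, Nat.add_sub_cancel, mul_pow, pow_add]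
    field_simp
  · intro n hn
    rw [Finset.mem_range] at hn
    simp [trinomialProb, Nat.choose_eq_zero_of_lt hn]

section

variable {Ω : Type*} [MeasurableSpace Ω] {μ : Measure Ω}
  {p q : ℝ} {Ξ : ℕ → Ω → ℕ → Bool}

/-- Membership in `U` depends only on the first `K` letters. -/
def DependsOnFirst (U : Set (ℕ → Bool)) (K : ℕ) : Prop :=
  ∀ s s' : ℕ → Bool, (∀ k < K, s k = s' k) → (s ∈ U ↔ s' ∈ U)

theorem dependsOnFirst_beginsWith {α : List Bool} {K : ℕ} (h : α.length ≤ K) :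
    DependsOnFirst {s | BeginsWith s α} K := by
  intro s s' hs
  simp only [Set.mem_ofPred_eq, BeginsWith]
  exact forall₂_congr fun k hk => by rw [hs k (by omega)]

theorem dependsOnFirst_empty (K : ℕ) : DependsOnFirst ∅ K := fun _ _ _ => by simp

theorem hitCount_congr {U : Set (ℕ → Bool)} {K n : ℕ} (hU : DependsOnFirst U K)
    {X Y : ℕ → ℕ → Bool} (h : ∀ i < n, ∀ k < K, X i k = Y i k) :
    hitCount U X n = hitCount U Y n := by
  classical
  unfold hitCount
  congr 1
  refine Finset.filter_congr fun i hi => hU _ _ (h i (by simpa using hi))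

theorem IsBernoulliStrings.measurable (hΞ : IsBernoulliStrings μ p Ξ) :
    Measurable fun ω i => Ξ i ω :=
  measurable_pi_lambda _ fun i => measurable_pi_lambda _ fun k => hΞ.measurable_letter i k

/-- Only finitely many letters matter, so independence of two disjoint finite blocks of letters
suffices, and every function of such a block is measurable. -/
theorem IsBernoulliStrings.indepFun_hitCount (hΞ : IsBernoulliStrings μ p Ξ)
    {U V : Set (ℕ → Bool)} {K : ℕ} (hU : DependsOnFirst U K) (hV : DependsOnFirst V K) (n : ℕ) :
    IndepFun (fun ω => (hitCount U (fun i => Ξ i ω) n, hitCount V (fun i => Ξ i ω) n))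
      (fun ω => (Ξ n ω ∈ U, Ξ n ω ∈ V)) μ := by
  classical
  have hdisj : Disjoint (Finset.range n ×ˢ Finset.range K) ({n} ×ˢ Finset.range K) := by
    rw [Finset.disjoint_left]
    rintro ⟨i, k⟩ h1 h2
    simp at h1 h2
    omega
  have h := hΞ.indep.indepFun_finset _ _ hdisj fun ik => hΞ.measurable_letter ik.1 ik.2
  -- The value `false` outside the block is harmless: `U` and `V` ignore letters from position `K`
  -- on, and `hitCount` ignores strings from index `n` on.
  let ext (S : Finset (ℕ × ℕ)) (v : S → Bool) : ℕ → ℕ → Bool := fun i k =>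
    if h : (i, k) ∈ S then v ⟨(i, k), h⟩ else false
  have := h.comp
    (Measurable.of_discrete (f := fun v => (hitCount U (ext _ v) n, hitCount V (ext _ v) n)))
    (Measurable.of_discrete (f := fun v => (ext _ v n ∈ U, ext _ v n ∈ V)))
  convert this using 1
  · ext1 ω
    have (i) (hi : i < n) (k) (hk : k < K) : Ξ i ω k = ext (Finset.range n ×ˢ Finset.range K)
        (fun ik => Ξ ik.1.1 ω ik.1.2) i k := by
      simp [ext, hi, hk]
    simp only [Function.comp]
    rw [hitCount_congr hU this, hitCount_congr hV this]
  · ext1 ω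
    have (k) (hk : k < K) : Ξ n ω k = ext ({n} ×ˢ Finset.range K)
        (fun ik => Ξ ik.1.1 ω ik.1.2) n k := by
      simp [ext, hk]
    simp only [Function.comp]
    rw [hU _ _ this, hV _ _ this]

variable [IsProbabilityMeasure μ]

theorem IsBernoulliStrings.hitCount_law (hΞ : IsBernoulliStrings μ p Ξ) {U V : Set (ℕ → Bool)}
    {K : ℕ} (hU : DependsOnFirst U K) (hV : DependsOnFirst V K) (hUm : MeasurableSet U)
    (hVm : MeasurableSet V) (hUV : Disjoint U V) {A B : ℝ}
    (hA : ∀ i, μ.real {ω | Ξ i ω ∈ U} = A) (hB : ∀ i, μ.real {ω | Ξ i ω ∈ V} = B) (n j i : ℕ) :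
    μ.real {ω | hitCount U (fun i => Ξ i ω) n = j ∧ hitCount V (fun i => Ξ i ω) n = i} =
      trinomialProb A B (1 - A - B) n j i := by
  classical
  have hmeas (i) : Measurable fun ω => Ξ i ω := (measurable_pi_apply i).comp hΞ.measurable
  have hU' (n) : MeasurableSet {ω | Ξ n ω ∈ U} := hmeas n hUm
  have hV' (n) : MeasurableSet {ω | Ξ n ω ∈ V} := hmeas n hVm
  have hc (n) : Measurable fun ω =>
      (hitCount U (fun i => Ξ i ω) n, hitCount V (fun i => Ξ i ω) n) :=
    ((measurable_hitCount hUm n).comp hΞ.measurable).prodMk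
      ((measurable_hitCount hVm n).comp hΞ.measurable)
  have hmul (n : ℕ) (S : Set (ℕ × ℕ)) (T : Set (Prop × Prop)) :
      μ.real ({ω | (hitCount U (fun i => Ξ i ω) n, hitCount V (fun i => Ξ i ω) n) ∈ S} ∩
        {ω | (Ξ n ω ∈ U, Ξ n ω ∈ V) ∈ T}) =
      μ.real {ω | (hitCount U (fun i => Ξ i ω) n, hitCount V (fun i => Ξ i ω) n) ∈ S} *
        μ.real {ω | (Ξ n ω ∈ U, Ξ n ω ∈ V) ∈ T} := by
    rw [measureReal_def, measureReal_def, measureReal_def, ← ENNReal.toReal_mul]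
    congr 1
    exact (hΞ.indepFun_hitCount hU hV n).measure_inter_preimage_eq_mul _ _ (.of_discrete)
      (.of_discrete)
  have hUV' (s : ℕ → Bool) (h : s ∈ U) : s ∉ V := fun h' => (Set.disjoint_left.1 hUV) h h'
  have hC (n) : μ.real {ω | Ξ n ω ∉ U ∧ Ξ n ω ∉ V} = 1 - A - B := by
    have h1 : {ω | Ξ n ω ∉ U ∧ Ξ n ω ∉ V} = ({ω | Ξ n ω ∈ U} ∪ {ω | Ξ n ω ∈ V})ᶜ := by
      ext ω; simp
    rw [h1, probReal_compl_eq_one_sub ((hU' n).union (hV' n)), measureReal_union _ (hV' n),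
      hA, hB]
    · ring
    · rw [Set.disjoint_left]
      exact fun ω h => hUV' _ h
  -- Condition on whether string n falls in U, in V or in neither. The result is the recursion
  -- satisfied by `trinomialProb`; writing the counts as `+ 1 = j` covers j = 0 and i = 0 without
  -- subtraction.
  have step (n j i : ℕ) :
      μ.real {ω | hitCount U (fun i => Ξ i ω) (n + 1) = j ∧
        hitCount V (fun i => Ξ i ω) (n + 1) = i} =
      A * μ.real {ω | hitCount U (fun i => Ξ i ω) n + 1 = j ∧
        hitCount V (fun i => Ξ i ω) n = i} +
      B * μ.real {ω | hitCount U (fun i => Ξ i ω) n = j ∧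
        hitCount V (fun i => Ξ i ω) n + 1 = i} +
      (1 - A - B) * μ.real {ω | hitCount U (fun i => Ξ i ω) n = j ∧
        hitCount V (fun i => Ξ i ω) n = i} := by
    have m1 := hmul n {x | x.1 + 1 = j ∧ x.2 = i} {x | x.1}
    have m2 := hmul n {x | x.1 = j ∧ x.2 + 1 = i} {x | x.2}
    have m3 := hmul n {x | x.1 = j ∧ x.2 = i} {x | ¬ x.1 ∧ ¬ x.2}
    simp only [Set.mem_ofPred_eq] at m1 m2 m3
    rw [hA] at m1
    rw [hB] at m2
    rw [hC] at m3
    have hS : MeasurableSet {ω | hitCount U (fun i => Ξ i ω) n = j ∧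
        hitCount V (fun i => Ξ i ω) n + 1 = i} :=
      hc n (Set.to_countable {x : ℕ × ℕ | x.1 = j ∧ x.2 + 1 = i}).measurableSet
    rw [mul_comm A, mul_comm B, mul_comm (1 - A - B), ← m1, ← m2, ← m3,
      ← measureReal_union (μ := μ) _ (hS.inter (hV' n)), ← measureReal_union (μ := μ)]
    · congr 1
      ext ω
      have e1 := hitCount_succ U (fun i => Ξ i ω) n
      have e2 := hitCount_succ V (fun i => Ξ i ω) n
      have e3 := hUV' (Ξ n ω)
      simp only [Set.mem_ofPred_eq, Set.mem_union, Set.mem_inter_iff]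
      by_cases h1 : Ξ n ω ∈ U <;> by_cases h2 : Ξ n ω ∈ V <;> simp_all
    · rw [Set.disjoint_left]
      rintro ω (h | h) h' <;> simp_all
    · exact (hc n (Set.to_countable {x : ℕ × ℕ | x.1 = j ∧ x.2 = i}).measurableSet).inter
        ((hU' n).compl.inter (hV' n).compl)
    · rw [Set.disjoint_left]
      rintro ω h h'
      exact hUV' _ h.2 h'.2
  induction n generalizing j i with
  | zero =>
    have (U) (ω) : hitCount U (fun i => Ξ i ω) 0 = 0 := by simp [hitCount]
    rcases j with _ | j <;> rcases i with _ | i <;> simp [this, trinomialProb, Nat.choose_eq_zero_of_lt]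
  | succ n ih =>
    rw [step]
    rcases j with _ | j <;> rcases i with _ | i
    · simp only [Nat.add_eq_zero_iff, one_ne_zero, and_false, false_and, ih,
        trinomialProb_succ_zero_zero]
      simp
    · simp only [Nat.add_eq_zero_iff, one_ne_zero, and_false, false_and, add_left_inj, ih,
        trinomialProb_succ_zero_succ]
      simp
    · simp only [Nat.add_eq_zero_iff, one_ne_zero, and_false, add_left_inj, ih,
        trinomialProb_succ_succ_zero]
      simp
    · simp only [add_left_inj, ih, trinomialProb_succ_succ_succ]

end

/-! ### The expected number of leaves -/

/-- The probability of a letter. -/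
def letterProb (p q : ℝ) (a : Bool) : ℝ := if a then p else q

/-- The probability that a random string begins with a given word. -/
noncomputable def wordProb (p q : ℝ) (α : List Bool) : ℝ := (α.map (letterProb p q)).prod

theorem wordProb_nonneg {p q : ℝ} (hp : 0 < p) (hq : 0 < q) (α : List Bool) :
    0 ≤ wordProb p q α := by
  induction α with
  | nil => simp [wordProb]
  | cons a α ih =>
    have : 0 ≤ letterProb p q a := by cases a <;> simp [letterProb, hp.le, hq.le]
    simpa [wordProb] using mul_nonneg this ih

theorem wordProb_concat (p q : ℝ) (α : List Bool) (a : Bool) :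
    wordProb p q (α ++ [a]) = wordProb p q α * letterProb p q a := by
  simp [wordProb]

theorem wordProb_cons (p q : ℝ) (α : List Bool) (a : Bool) :
    wordProb p q (a :: α) = letterProb p q a * wordProb p q α := by
  simp [wordProb]

/-- The probability that a child of a given node is a leaf storing `j` of `n` strings, when a
string reaches this child with probability `A` and its sibling with probability `B`. -/
noncomputable def childLeafProb (b j : ℕ) (A B : ℝ) (n : ℕ) : ℝ :=
  trinomialProb A 0 (1 - A) n j 0 -
    ∑ i ∈ Finset.range (b - j + 1), trinomialProb A B (1 - A - B) n j i

theorem hasSum_poissonProb_mul_childLeafProb (b j : ℕ) (A B x : ℝ) :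
    HasSum (fun n => poissonProb x n * childLeafProb b j A B n)
      (poissonProb (x * A) j *
        (1 - ∑ i ∈ Finset.range (b - j + 1), poissonProb (x * B) i)) := by
  have h1 := hasSum_poissonProb_mul_trinomialProb (A := A) (B := 0) (C := 1 - A) (by ring) x j 0
  have h2 := hasSum_sum fun i (_ : i ∈ Finset.range (b - j + 1)) =>
    hasSum_poissonProb_mul_trinomialProb (A := A) (B := B) (C := 1 - A - B) (by ring) x j i
  have h3 := h1.sub h2
  rw [← Finset.mul_sum, ← mul_sub] at h3
  simp only [← Finset.mul_sum, ← mul_sub] at h3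
  simpa [poissonProb, childLeafProb] using h3

theorem poissonProb_nonneg {x : ℝ} (hx : 0 ≤ x) (k : ℕ) : 0 ≤ poissonProb x k := by
  unfold poissonProb; positivity

theorem hasSum_poissonProb (x : ℝ) : HasSum (poissonProb x) 1 := by
  have h1 : HasSum (fun n : ℕ => x ^ n / n !) (exp x) := by
    rw [Real.exp_eq_exp_ℝ]; exact NormedSpace.expSeries_div_hasSum_exp _
  have h2 := h1.mul_left (exp (-x))
  rw [← exp_add, neg_add_cancel, exp_zero] at h2
  exact h2.congr_eq fun n => mul_div_assoc _ _ _

theorem sum_poissonProb_le_one {x : ℝ} (hx : 0 ≤ x) (s : Finset ℕ) :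
    ∑ k ∈ s, poissonProb x k ≤ 1 :=
  sum_le_hasSum s (fun k _ => poissonProb_nonneg hx k) (hasSum_poissonProb x)

section

variable {Ω : Type*} [MeasurableSpace Ω] {μ : Measure Ω}
  {p q : ℝ} {Ξ : ℕ → Ω → ℕ → Bool} {b j : ℕ}

theorem fLeaf_nonneg (hp : 0 < p) (hq : 0 < q) {x : ℝ} (hx : 0 ≤ x) : 0 ≤ fLeaf p q b j x := by
  have h1 := sum_poissonProb_le_one (mul_nonneg hp.le hx) (Finset.range (b - j + 1))
  have h2 := sum_poissonProb_le_one (mul_nonneg hq.le hx) (Finset.range (b - j + 1))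
  exact add_nonneg (mul_nonneg (poissonProb_nonneg (by positivity) _) (by linarith))
    (mul_nonneg (poissonProb_nonneg (by positivity) _) (by linarith))

/-- The expected number of leaves storing exactly `j` strings, as an extended nonnegative real. -/
noncomputable def leafMean (μ : Measure Ω) (Ξ : ℕ → Ω → ℕ → Bool) (b j n : ℕ) : ENNReal :=
  ∫⁻ ω, leafCount b j (fun i => Ξ i ω) n ∂μ

theorem IsBernoulliStrings.measurable_leafCount (hΞ : IsBernoulliStrings μ p Ξ)
    (hj : 1 ≤ j) (hjb : j ≤ b) (n : ℕ) :
    Measurable fun ω => (leafCount b j (fun i => Ξ i ω) n : ENNReal) :=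
  (_root_.measurable_leafCount hj hjb n).comp hΞ.measurable

theorem IsBernoulliStrings.expectedLeaves_eq (hΞ : IsBernoulliStrings μ p Ξ)
    (hj : 1 ≤ j) (hjb : j ≤ b) (n : ℕ) :
    expectedLeaves μ Ξ b j n = (leafMean μ Ξ b j n).toReal := by
  rw [expectedLeaves, integral_eq_lintegral_of_nonneg_ae]
  · simp [leafMean]
  · exact Eventually.of_forall fun ω => by positivity
  · simpa using (hΞ.measurable_leafCount hj hjb n).ennreal_toReal.aestronglyMeasurable

theorem expectedLeaves_nonneg (n : ℕ) : 0 ≤ expectedLeaves μ Ξ b j n :=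
  integral_nonneg fun ω => by positivity

/-- Decompose over the values of N and use its independence from the strings. In extended
nonnegative reals the sum and the integral commute freely, and the same decomposition supplies
measurability of the leaf count at the random index. -/
theorem IsPoissonNumber.expectedLeavesRandom_eq {N : ℝ≥0 → Ω → ℕ} (hN : IsPoissonNumber μ Ξ N)
    (hΞ : IsBernoulliStrings μ p Ξ) (hj : 1 ≤ j) (hjb : j ≤ b) (l : ℝ≥0) :
    expectedLeavesRandom μ Ξ b j (N l) =
      (∑' n, ENNReal.ofReal (poissonProb l n) * leafMean μ Ξ b j n).toReal := by
  classical
  have hmN := (hN.law l).aemeasurable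
  have hae : ∀ᵐ ω ∂μ, (leafCount b j (fun i => Ξ i ω) (N l ω) : ENNReal) =
      ∑' n, (({n} : Set ℕ).indicator 1 (N l ω) : ENNReal) * leafCount b j (fun i => Ξ i ω) n :=
    Eventually.of_forall fun ω => by
      rw [tsum_eq_single (N l ω)]
      · simp
      · intro n hn
        simp [hn.symm]
  have hmeas (n : ℕ) : AEMeasurable (fun ω => (({n} : Set ℕ).indicator 1 (N l ω) : ENNReal)) μ :=
    (Measurable.of_discrete (f := fun m : ℕ => (({n} : Set ℕ).indicator 1 m : ENNReal)))
      |>.comp_aemeasurable hmN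
  have hm2 (n : ℕ) : AEMeasurable (fun ω => (({n} : Set ℕ).indicator 1 (N l ω) : ENNReal) *
      leafCount b j (fun i => Ξ i ω) n) μ :=
    (hmeas n).mul (hΞ.measurable_leafCount hj hjb n).aemeasurable
  have hm3 : AEMeasurable (fun ω => (leafCount b j (fun i => Ξ i ω) (N l ω) : ENNReal)) μ :=
    (AEMeasurable.tsum hm2).congr (hae.mono fun _ h => h.symm)
  rw [expectedLeavesRandom, integral_eq_lintegral_of_nonneg_ae]
  · congr 1
    simp only [ENNReal.ofReal_natCast]
    rw [lintegral_congr_ae hae, lintegral_tsum hm2]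
    refine tsum_congr fun n => ?_
    have hind : IndepFun (fun ω => (({n} : Set ℕ).indicator 1 (N l ω) : ENNReal))
        (fun ω => (leafCount b j (fun i => Ξ i ω) n : ENNReal)) μ :=
      (hN.indep l).comp
        (Measurable.of_discrete (f := fun m : ℕ => (({n} : Set ℕ).indicator 1 m : ENNReal)))
        (_root_.measurable_leafCount hj hjb n)
    have h1 := lintegral_mul_eq_lintegral_mul_lintegral_of_indepFun'' (hmeas n)
      (hΞ.measurable_leafCount hj hjb n).aemeasurable hind
    rw [h1, leafMean]
    congr 1
    have h2 := lintegral_map' (μ := μ) (g := N l)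
      (f := fun m => (({n} : Set ℕ).indicator 1 m : ENNReal)) Measurable.of_discrete.aemeasurable hmN
    rw [← h2, (hN.law l).map_eq, lintegral_indicator_one (measurableSet_singleton n),
      poissonMeasure_singleton, poissonProb]
  · exact Eventually.of_forall fun ω => by positivity
  · simpa using hm3.ennreal_toReal.aestronglyMeasurable

variable [IsProbabilityMeasure μ]

theorem IsBernoulliStrings.letter_law (hpq : p + q = 1) (hΞ : IsBernoulliStrings μ p Ξ)
    (i k : ℕ) (a : Bool) : μ.real {ω | Ξ i ω k = a} = letterProb p q a := by
  cases a
  · have h1 : {ω | Ξ i ω k = false} = {ω | Ξ i ω k = true}ᶜ := by ext ω; simp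
    have h2 : MeasurableSet {ω | Ξ i ω k = true} :=
      hΞ.measurable_letter i k (measurableSet_singleton true)
    rw [h1, probReal_compl_eq_one_sub h2, hΞ.prob_one]
    simp [letterProb]; linarith
  · simpa [letterProb] using hΞ.prob_one i k

theorem IsBernoulliStrings.beginsWith_law (hpq : p + q = 1) (hΞ : IsBernoulliStrings μ p Ξ)
    (i : ℕ) (α : List Bool) : μ.real {ω | BeginsWith (Ξ i ω) α} = wordProb p q α := by
  have hinj : Function.Injective fun k : Fin α.length => ((i, k) : ℕ × ℕ) := by
    intro k l h; simpa [Fin.ext_iff] using h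
  have h := (hΞ.indep.precomp hinj).meas_iInter
    (s := fun k : Fin α.length => {ω | Ξ i ω k = α[k]})
    fun k => ⟨{α[k]}, .of_discrete, rfl⟩
  have h1 : {ω | BeginsWith (Ξ i ω) α} = ⋂ k : Fin α.length, {ω | Ξ i ω k = α[k]} := by
    ext ω; simp [BeginsWith, Fin.forall_iff]
  rw [h1, measureReal_def, h, ENNReal.toReal_prod, wordProb, ← Fin.prod_univ_fun_getElem]
  exact Finset.prod_congr rfl fun k _ => hΞ.letter_law hpq i k _

/-- The parent's count is the sum of the children's, so it exceeds b exactly when the sibling's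
count is not one of 0, …, b - j. The marginal law of the child is the trinomial law with an empty
second set. -/
theorem IsBernoulliStrings.childLeaf_law (hpq : p + q = 1) (hΞ : IsBernoulliStrings μ p Ξ)
    (hj : 1 ≤ j) (hjb : j ≤ b) (n : ℕ) (β : List Bool) (a : Bool) :
    μ.real {ω | β ++ [a] ∈ leafSet b j (fun i => Ξ i ω) n} =
      childLeafProb b j (wordProb p q β * letterProb p q a)
        (wordProb p q β * letterProb p q (!a)) n := by
  classical
  have hdep (a) : DependsOnFirst {s | BeginsWith s (β ++ [a])} (β.length + 1) :=
    dependsOnFirst_beginsWith (by simp)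
  have hlaw (a) (i) : μ.real {ω | Ξ i ω ∈ {s | BeginsWith s (β ++ [a])}} =
      wordProb p q β * letterProb p q a := by
    rw [← wordProb_concat]
    exact hΞ.beginsWith_law hpq i _
  have h1 := hΞ.hitCount_law (hdep a) (dependsOnFirst_empty _) (measurableSet_beginsWith _)
    MeasurableSet.empty (Set.disjoint_empty _) (hlaw a) (B := 0) (by simp) n j 0
  have h2 (i) := hΞ.hitCount_law (hdep a) (hdep (!a)) (measurableSet_beginsWith _)
    (measurableSet_beginsWith _) (by
      rw [Set.disjoint_left]
      intro s h1 h2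
      have := (beginsWith_concat.1 h1).2.symm.trans (beginsWith_concat.1 h2).2
      cases a <;> simp at this) (hlaw a) (hlaw (!a)) n j i
  simp only [hitCount_empty, and_true, sub_zero, ← prefixCount_eq_hitCount] at h1 h2
  have hm (α) : Measurable fun ω => prefixCount (fun i => Ξ i ω) n α :=
    (measurable_prefixCount n α).comp hΞ.measurable
  have hme (α k) : MeasurableSet {ω | prefixCount (fun i => Ξ i ω) n α = k} :=
    hm α (measurableSet_singleton k)
  rw [childLeafProb, ← h1, ← Finset.sum_congr rfl fun i _ => h2 i,
    ← measureReal_biUnion_finset, ← measureReal_sdiff]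
  · congr 1
    ext ω
    have := prefixCount_split (X := fun i => Ξ i ω) (n := n) (α := β) a
    simp only [concat_mem_leafSet_iff hj hjb, Set.mem_ofPred_eq, Set.mem_sdiff, Set.mem_iUnion,
      Finset.mem_range, exists_prop, not_exists, not_and]
    constructor
    · rintro ⟨h3, h4⟩
      exact ⟨h4, fun i hi _ => by omega⟩
    · rintro ⟨h3, h4⟩
      refine ⟨?_, h3⟩
      by_contra h5
      exact h4 _ (by omega) h3 rfl
  · refine Set.iUnion₂_subset fun i _ ω h => h.1
  · exact Finset.measurableSet_biUnion _ fun i _ => (hme _ _).inter (hme _ _)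
  · intro i _ k _ hik
    rw [Function.onFun, Set.disjoint_left]
    exact fun ω h h' => hik (h.2.symm.trans h'.2)
  · exact fun i _ => (hme _ _).inter (hme _ _)

theorem leafMean_le (hj : 1 ≤ j) (hjb : j ≤ b) (n : ℕ) : leafMean μ Ξ b j n ≤ n := by
  calc leafMean μ Ξ b j n ≤ ∫⁻ _, n ∂μ :=
        lintegral_mono fun ω => Nat.cast_le.2 (leafCount_le hj hjb)
    _ = n := by simp

theorem IsBernoulliStrings.ofReal_expectedLeaves (hΞ : IsBernoulliStrings μ p Ξ)
    (hj : 1 ≤ j) (hjb : j ≤ b) (n : ℕ) :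
    ENNReal.ofReal (expectedLeaves μ Ξ b j n) = leafMean μ Ξ b j n := by
  rw [hΞ.expectedLeaves_eq hj hjb, ENNReal.ofReal_toReal]
  exact ((leafMean_le hj hjb n).trans_lt (by simp)).ne

theorem IsBernoulliStrings.expectedLeaves_le (hΞ : IsBernoulliStrings μ p Ξ)
    (hj : 1 ≤ j) (hjb : j ≤ b) (n : ℕ) : expectedLeaves μ Ξ b j n ≤ n := by
  rw [hΞ.expectedLeaves_eq hj hjb]
  exact ENNReal.toReal_le_of_le_ofReal (by positivity) (by simpa using leafMean_le hj hjb n)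

theorem IsBernoulliStrings.integrable_leafCount (hΞ : IsBernoulliStrings μ p Ξ)
    (hj : 1 ≤ j) (hjb : j ≤ b) (n : ℕ) :
    Integrable (fun ω => (leafCount b j (fun i => Ξ i ω) n : ℝ)) μ := by
  refine Integrable.of_bound (C := n) ?_ (Eventually.of_forall fun ω => ?_)
  · simpa using (hΞ.measurable_leafCount hj hjb n).ennreal_toReal.aestronglyMeasurable
  · simpa using leafCount_le hj hjb

theorem IsBernoulliStrings.abs_expectedLeaves_succ_sub_le (hΞ : IsBernoulliStrings μ p Ξ)
    (hj : 1 ≤ j) (hjb : j ≤ b) (n : ℕ) :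
    |expectedLeaves μ Ξ b j (n + 1) - expectedLeaves μ Ξ b j n| ≤ 2 := by
  unfold expectedLeaves
  rw [← integral_sub (hΞ.integrable_leafCount hj hjb _) (hΞ.integrable_leafCount hj hjb _)]
  have h : ∀ᵐ ω ∂μ, ‖(leafCount b j (fun i => Ξ i ω) (n + 1) : ℝ) -
      leafCount b j (fun i => Ξ i ω) n‖ ≤ 2 :=
    Eventually.of_forall fun ω => abs_leafCount_succ_sub_le hj hjb
  simpa using norm_integral_le_of_norm_le_const h

theorem IsBernoulliStrings.leafMean_eq (hpq : p + q = 1) (hΞ : IsBernoulliStrings μ p Ξ)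
    (hj : 1 ≤ j) (hjb : j ≤ b) (n : ℕ) :
    leafMean μ Ξ b j n = (if n = j then 1 else 0) + ∑' β, ∑ a : Bool, ENNReal.ofReal
      (childLeafProb b j (wordProb p q β * letterProb p q a)
        (wordProb p q β * letterProb p q (!a)) n) := by
  have hm (α) : MeasurableSet {ω | α ∈ leafSet b j (fun i => Ξ i ω) n} :=
    hΞ.measurable (measurableSet_mem_leafSet hj hjb n α)
  have h1 : leafMean μ Ξ b j n = ∑' α, μ {ω | α ∈ leafSet b j (fun i => Ξ i ω) n} := by
    have : leafMean μ Ξ b j n =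
        ∫⁻ ω, ∑' α, {ω | α ∈ leafSet b j (fun i => Ξ i ω) n}.indicator 1 ω ∂μ :=
      lintegral_congr fun ω => leafCount_eq_tsum hj hjb _ _
    rw [this, lintegral_tsum fun α => (measurable_one.indicator (hm α)).aemeasurable]
    exact tsum_congr fun α => lintegral_indicator_one (hm α)
  rw [h1, tsum_list_concat]
  congr 1
  · simp only [nil_mem_leafSet_iff hj hjb]
    split_ifs with h <;> simp [h]
  · refine tsum_congr fun β => ?_
    rw [Fintype.sum_bool, ← hΞ.childLeaf_law hpq hj hjb, ← hΞ.childLeaf_law hpq hj hjb,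
      ofReal_measureReal, ofReal_measureReal]

/-- The first term is the root, which is a leaf storing j strings only when n = j. For each parent
β, thinning makes the two children independent, and their contributions add up to f_j at x P(β). -/
theorem IsBernoulliStrings.tsum_poissonProb_mul_leafMean (hp : 0 < p) (hq : 0 < q)
    (hpq : p + q = 1) (hΞ : IsBernoulliStrings μ p Ξ) (hj : 1 ≤ j) (hjb : j ≤ b) {x : ℝ}
    (hx : 0 ≤ x) :
    ∑' n, ENNReal.ofReal (poissonProb x n) * leafMean μ Ξ b j n =
      ENNReal.ofReal (poissonProb x j) +
        ∑' β, ENNReal.ofReal (fLeaf p q b j (x * wordProb p q β)) := by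
  simp only [hΞ.leafMean_eq hpq hj hjb, mul_add, ENNReal.tsum_add]
  congr 1
  · rw [tsum_eq_single j]
    · simp
    · intro n hn; simp [hn]
  · simp only [← ENNReal.tsum_mul_left]
    rw [ENNReal.tsum_comm]
    refine tsum_congr fun β => ?_
    have hw := wordProb_nonneg hp hq β
    have hs (a : Bool) : ∑' n, ENNReal.ofReal (poissonProb x n) * ENNReal.ofReal
          (childLeafProb b j (wordProb p q β * letterProb p q a)
            (wordProb p q β * letterProb p q (!a)) n) =
        ENNReal.ofReal (poissonProb (x * (wordProb p q β * letterProb p q a)) j *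
        (1 - ∑ i ∈ Finset.range (b - j + 1),
          poissonProb (x * (wordProb p q β * letterProb p q (!a))) i)) := by
      have h1 := hasSum_poissonProb_mul_childLeafProb b j (wordProb p q β * letterProb p q a)
        (wordProb p q β * letterProb p q (!a)) x
      rw [← h1.tsum_eq, ENNReal.ofReal_tsum_of_nonneg _ h1.summable]
      · exact tsum_congr fun n => (ENNReal.ofReal_mul (poissonProb_nonneg hx n)).symm
      · intro n
        refine mul_nonneg (poissonProb_nonneg hx n) ?_
        rw [← hΞ.childLeaf_law hpq hj hjb]
        exact measureReal_nonneg
    simp only [Fintype.sum_bool, mul_add, ENNReal.tsum_add, hs]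
    have hn (A B : ℝ) (hA : 0 ≤ A) (hB : 0 ≤ B) : 0 ≤ poissonProb (x * (wordProb p q β * A)) j *
        (1 - ∑ i ∈ Finset.range (b - j + 1), poissonProb (x * (wordProb p q β * B)) i) :=
      mul_nonneg (poissonProb_nonneg (by positivity) _)
        (sub_nonneg.2 (sum_poissonProb_le_one (by positivity) _))
    rw [← ENNReal.ofReal_add]
    · congr 1
      simp only [fLeaf, letterProb]
      have e (r : ℝ) : x * (wordProb p q β * r) = r * (x * wordProb p q β) := by ring
      simp [e]
    · exact hn _ _ (by simp [letterProb, hp.le]) (by simp [letterProb, hq.le])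
    · exact hn _ _ (by simp [letterProb, hq.le]) (by simp [letterProb, hp.le])

end

/-! ### Poisson transforms of sequences -/

/-- The expectation of `a N` for a Poisson variable `N` of mean `x`. -/
noncomputable def poissonTransform (a : ℕ → ℝ) (x : ℝ) : ℝ := ∑' n, poissonProb x n * a n

theorem poissonProb_succ_mul (x : ℝ) (n : ℕ) :
    poissonProb x (n + 1) * (n + 1 : ℕ) = x * poissonProb x n := by
  simp only [poissonProb, Nat.factorial_succ, Nat.cast_mul, pow_succ]
  field_simp

theorem hasSum_poissonProb_mul_nat (x : ℝ) : HasSum (fun n : ℕ => poissonProb x n * n) x := by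
  rw [← hasSum_nat_add_iff' 1]
  simpa only [poissonProb_succ_mul, Finset.sum_range_one, Nat.cast_zero, mul_zero, sub_zero,
    mul_one] using (hasSum_poissonProb x).mul_left x

theorem hasSum_poissonProb_mul_sq (x : ℝ) :
    HasSum (fun n : ℕ => poissonProb x n * (n : ℝ) ^ 2) (x ^ 2 + x) := by
  rw [← hasSum_nat_add_iff' 1]
  have h := ((hasSum_poissonProb_mul_nat x).add (hasSum_poissonProb x)).mul_left x
  have e : x * (x + 1) = x ^ 2 + x - ∑ i ∈ Finset.range 1, poissonProb x i * (i : ℝ) ^ 2 := by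
    simp; ring
  rw [← e]
  refine h.congr_eq fun n => ?_
  rw [pow_two, ← mul_assoc, poissonProb_succ_mul]
  push_cast
  ring

section

variable {a : ℕ → ℝ} {C : ℝ}

theorem summable_poissonProb_mul (ha : ∀ n, |a n| ≤ n) {x : ℝ} (hx : 0 ≤ x) :
    Summable fun n => poissonProb x n * a n := by
  refine Summable.of_norm_bounded (hasSum_poissonProb_mul_nat x).summable fun n => ?_
  rw [norm_mul, Real.norm_of_nonneg (poissonProb_nonneg hx n)]
  exact mul_le_mul_of_nonneg_left (ha n) (poissonProb_nonneg hx n)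

theorem poissonTransform_nonneg (h0 : ∀ n, 0 ≤ a n) {x : ℝ} (hx : 0 ≤ x) :
    0 ≤ poissonTransform a x :=
  tsum_nonneg fun n => mul_nonneg (poissonProb_nonneg hx n) (h0 n)

theorem poissonTransform_le (ha : ∀ n, |a n| ≤ n) {x : ℝ} (hx : 0 ≤ x) :
    poissonTransform a x ≤ x := by
  refine LE.le.trans_eq ?_ (hasSum_poissonProb_mul_nat x).tsum_eq
  exact (summable_poissonProb_mul ha hx).tsum_le_tsum
    (fun n => mul_le_mul_of_nonneg_left ((le_abs_self _).trans (ha n)) (poissonProb_nonneg hx n))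
    (hasSum_poissonProb_mul_nat x).summable

/-- Since a 1 = 0, the terms satisfy a n ≤ n(n - 1), and the second factorial moment of Po(x) is x².
This makes the renewal solution vanish at -∞. -/
theorem poissonTransform_le_sq (ha : ∀ n, |a n| ≤ n) (h1 : a 1 = 0) {x : ℝ} (hx : 0 ≤ x) :
    poissonTransform a x ≤ x ^ 2 := by
  have h := (hasSum_poissonProb_mul_sq x).sub (hasSum_poissonProb_mul_nat x)
  rw [add_sub_cancel_right] at h
  rw [← h.tsum_eq]
  refine (summable_poissonProb_mul ha hx).tsum_le_tsum (fun n => ?_) h.summable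
  rw [← mul_sub]
  refine mul_le_mul_of_nonneg_left ?_ (poissonProb_nonneg hx n)
  rcases n with _ | _ | n
  · simpa using (le_abs_self _).trans (ha 0)
  · simp [h1]
  · refine ((le_abs_self _).trans (ha _)).trans ?_
    push_cast
    nlinarith [(Nat.cast_nonneg n : (0 : ℝ) ≤ n)]

/-- The derivative is the Poisson transform of the increments, so bounded increments give a
Lipschitz transform. -/
theorem hasDerivAt_poissonTransform (ha : ∀ n, |a n| ≤ n) (x : ℝ) (hx : 0 ≤ x) :
    HasDerivAt (poissonTransform a) (∑' n, poissonProb x n * (a (n + 1) - a n)) x := by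
  have h0 : a 0 = 0 := by simpa using ha 0
  -- Differentiate termwise on the ball of radius x + 1, which contains x. Since a 0 = 0, the series
  -- may start at index 1, so that the derivative of each term is again a power over a factorial.
  set R := x + 1
  have hR : 0 ≤ R := by positivity
  have hu : Summable fun m : ℕ => ((m : ℝ) + 1) * (R ^ m / m !) := by
    have := ((hasSum_poissonProb_mul_nat R).add (hasSum_poissonProb R)).mul_left (exp R)
    refine (this.congr_eq fun m => ?_).summable
    simp only [poissonProb, exp_neg]
    field_simp
  have hd := hasDerivAt_tsum_of_isPreconnected (𝕜 := ℝ) (t := Metric.ball 0 R)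
    (g := fun m y => a (m + 1) * (y ^ (m + 1) / (m + 1)!)) (g' := fun m y => a (m + 1) * (y ^ m / m !))
    (y₀ := 0) (y := x) hu Metric.isOpen_ball (convex_ball 0 R).isPreconnected
    (fun m y _ => by
      have h := ((hasDerivAt_pow (m + 1) y).div_const ((m + 1)! : ℝ)).const_mul (a (m + 1))
      refine h.congr_deriv ?_
      rw [Nat.factorial_succ]
      push_cast
      field_simp)
    (fun m y hy => by
      rw [norm_mul, norm_div, norm_pow, Real.norm_natCast]
      have hy' : ‖y‖ ≤ R := by simpa using (mem_ball_zero_iff.1 hy).le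
      have := ha (m + 1)
      push_cast at this
      exact mul_le_mul this (by gcongr) (by positivity) (by positivity))
    (Metric.mem_ball_self (by positivity)) (by simp [summable_zero])
    (by rw [mem_ball_zero_iff, Real.norm_of_nonneg hx]; simp [R])
  have hF : poissonTransform a =
      fun x => exp (-x) * ∑' m, a (m + 1) * (x ^ (m + 1) / (m + 1)!) := by
    ext y
    rw [← tsum_mul_left, poissonTransform]
    have hinj : Function.Injective Nat.succ := Nat.succ_injective
    rw [← hinj.tsum_eq]
    · exact tsum_congr fun n => by simp only [poissonProb, Nat.succ_eq_add_one]; ring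
    · intro n hn
      rcases n with _ | n
      · simp [h0] at hn
      · exact ⟨n, rfl⟩
  have hd2 := ((hasDerivAt_neg x).exp).mul hd
  rw [hF]
  refine hd2.congr_deriv ?_
  have hs1 := summable_poissonProb_mul ha hx
  have hs2 : Summable fun n => poissonProb x n * a (n + 1) := by
    refine Summable.of_norm_bounded
      ((hasSum_poissonProb_mul_nat x).add (hasSum_poissonProb x)).summable fun n => ?_
    rw [norm_mul, Real.norm_of_nonneg (poissonProb_nonneg hx n), ← mul_add_one]
    have := ha (n + 1)
    push_cast at this
    exact mul_le_mul_of_nonneg_left this (poissonProb_nonneg hx n)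
  simp only [mul_sub]
  rw [hs2.tsum_sub hs1]
  have := congrFun hF x
  rw [poissonTransform] at this
  rw [this]
  have e : ∑' n, exp (-x) * (a (n + 1) * (x ^ n / n !)) = ∑' n, poissonProb x n * a (n + 1) :=
    tsum_congr fun n => by simp only [poissonProb]; ring
  rw [← e, tsum_mul_left]
  ring

theorem abs_poissonTransform_sub_le (ha : ∀ n, |a n| ≤ n) (hC : ∀ n, |a (n + 1) - a n| ≤ C)
    {x y : ℝ} (hx : 0 ≤ x) (hy : 0 ≤ y) :
    |poissonTransform a x - poissonTransform a y| ≤ C * |x - y| := by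
  refine (convex_Ici (0 : ℝ)).norm_image_sub_le_of_norm_hasDerivWithin_le
    (f' := fun x => ∑' n, poissonProb x n * (a (n + 1) - a n))
    (fun x hx => (hasDerivAt_poissonTransform ha x hx).hasDerivWithinAt) (fun x hx => ?_) hy hx
  have h := (hasSum_poissonProb x).mul_right C
  rw [one_mul] at h
  refine tsum_of_norm_bounded h fun n => ?_
  rw [norm_mul, Real.norm_of_nonneg (poissonProb_nonneg hx n)]
  exact mul_le_mul_of_nonneg_left (hC n) (poissonProb_nonneg hx n)

theorem abs_sub_le_mul_abs_sub (hC : ∀ n, |a (n + 1) - a n| ≤ C) (m n : ℕ) :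
    |a n - a m| ≤ C * |(n : ℝ) - m| := by
  wlog h : m ≤ n generalizing m n
  · rw [abs_sub_comm, abs_sub_comm (n : ℝ)]
    exact this n m (le_of_not_ge h)
  induction n, h using Nat.le_induction with
  | base => simp
  | succ n h ih =>
    have h' : (m : ℝ) ≤ n := by exact_mod_cast h
    rw [abs_of_nonneg (sub_nonneg.2 h')] at ih
    rw [abs_of_nonneg (a := ((n + 1 : ℕ) : ℝ) - m) (by push_cast; linarith)]
    push_cast
    have := abs_sub_le (a (n + 1)) (a n) (a m)
    linarith [hC n]

/-- The difference is at most C E|N - m| for N of law Po(m), whose variance is m. Instead of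
Cauchy–Schwarz, the pointwise bound 2|y| ≤ y²/√m + √m is integrated. -/
theorem abs_poissonTransform_nat_sub_le (ha : ∀ n, |a n| ≤ n) (hC : ∀ n, |a (n + 1) - a n| ≤ C)
    {m : ℕ} (hm : 0 < m) : |poissonTransform a m - a m| ≤ C * √m := by
  have hm' : (0 : ℝ) < m := by exact_mod_cast hm
  have hC0 : 0 ≤ C := (abs_nonneg _).trans (hC 0)
  have h1 : HasSum (fun n => poissonProb m n * (a n - a m)) (poissonTransform a m - a m) := by
    have := (summable_poissonProb_mul ha hm'.le).hasSum.sub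
      ((hasSum_poissonProb (m : ℝ)).mul_right (a m))
    rw [one_mul] at this
    exact this.congr_eq fun n => mul_sub _ _ _
  have h2 : HasSum (fun n : ℕ => poissonProb m n * (C * (((n : ℝ) - m) ^ 2 / √m + √m) / 2))
      (C * √m) := by
    have := (((((hasSum_poissonProb_mul_sq (m : ℝ)).sub
      ((hasSum_poissonProb_mul_nat (m : ℝ)).mul_left (2 * (m : ℝ)))).add
      ((hasSum_poissonProb (m : ℝ)).mul_left ((m : ℝ) ^ 2))).mul_left (1 / √m)).add
      ((hasSum_poissonProb (m : ℝ)).mul_left (√m))).mul_left (C / 2)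
    have e : C / 2 * (1 / √m * ((m : ℝ) ^ 2 + m - 2 * m * m + (m : ℝ) ^ 2 * 1) + √m * 1) =
        C * √m := by
      have : (m : ℝ) = √m * √m := (mul_self_sqrt hm'.le).symm
      have h3 : (m : ℝ) ^ 2 + m - 2 * m * m + (m : ℝ) ^ 2 * 1 = √m * √m := by
        rw [← this]; ring
      rw [h3]
      have := sqrt_pos.2 hm'
      field_simp
      ring
    rw [e] at this
    exact this.congr_eq fun n => by ring
  rw [← h1.tsum_eq, ← Real.norm_eq_abs]
  refine tsum_of_norm_bounded h2 fun n => ?_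
  rw [norm_mul, Real.norm_of_nonneg (poissonProb_nonneg hm'.le n)]
  refine mul_le_mul_of_nonneg_left ((abs_sub_le_mul_abs_sub hC m n).trans ?_)
    (poissonProb_nonneg hm'.le n)
  rw [mul_div_assoc]
  refine mul_le_mul_of_nonneg_left ?_ hC0
  have := sqrt_pos.2 hm'
  rw [le_div_iff₀ two_pos, ← sub_nonneg]
  have e : ((n : ℝ) - m) ^ 2 / √m + √m - |(n : ℝ) - m| * 2 = (|(n : ℝ) - m| - √m) ^ 2 / √m := by
    rw [← sq_abs]
    field_simp
    ring
  rw [e]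
  positivity

theorem tendsto_poissonTransform_nat_sub_div (ha : ∀ n, |a n| ≤ n)
    (hC : ∀ n, |a (n + 1) - a n| ≤ C) :
    Tendsto (fun n : ℕ => a n / n - poissonTransform a n / n) atTop (𝓝 0) := by
  have h : Tendsto (fun n : ℕ => C * (√n)⁻¹) atTop (𝓝 0) := by
    have := (tendsto_inv_atTop_zero.comp
      (tendsto_sqrt_atTop.comp tendsto_natCast_atTop_atTop)).const_mul C
    rwa [mul_zero] at this
  refine squeeze_zero_norm' ?_ h
  filter_upwards [eventually_gt_atTop 0] with n hn
  have hn' : (0 : ℝ) < n := by exact_mod_cast hn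
  rw [← sub_div, norm_div, Real.norm_of_nonneg hn'.le, div_le_iff₀ hn', norm_sub_rev]
  refine (abs_poissonTransform_nat_sub_le ha hC hn).trans (le_of_eq ?_)
  have := sqrt_pos.2 hn'
  field_simp
  rw [sq_sqrt hn'.le]

end

/-! ### The Poisson transform of the expected number of leaves -/

theorem leafCount_of_le {b j n : ℕ} {X : ℕ → ℕ → Bool} (hj : 1 ≤ j) (hjb : j ≤ b) (hn : n ≤ b) :
    leafCount b j X n = if n = j then 1 else 0 := by
  have h : leafSet b j X n = if n = j then {[]} else ∅ := by
    ext α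
    rcases List.eq_nil_or_concat' α with rfl | ⟨β, a, rfl⟩
    · rw [nil_mem_leafSet_iff hj hjb]
      split_ifs with h <;> simp [h]
    · have h1 := prefixCount_anti (X := X) (n := n) (List.nil_prefix (l := β))
      rw [prefixCount_nil] at h1
      rw [concat_mem_leafSet_iff hj hjb]
      split_ifs
      · simp; omega
      · simp; omega
  rw [leafCount_eq_ncard, h]
  split_ifs <;> simp

/-- The expected number of leaves storing `j` strings, other than the root. -/
noncomputable def childLeaves {Ω : Type*} [MeasurableSpace Ω] (μ : Measure Ω)
    (Ξ : ℕ → Ω → ℕ → Bool) (b j n : ℕ) : ℝ :=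
  expectedLeaves μ Ξ b j n - if n = j then 1 else 0

section

variable {Ω : Type*} [MeasurableSpace Ω] {μ : Measure Ω}
  {p q : ℝ} {Ξ : ℕ → Ω → ℕ → Bool} {b j : ℕ}

theorem childLeaves_of_lt (hjb : j ≤ b) {n : ℕ} (hn : b < n) :
    childLeaves μ Ξ b j n = expectedLeaves μ Ξ b j n := by
  simp [childLeaves, show n ≠ j by omega]

variable [IsProbabilityMeasure μ]

/-- With at most b strings only the root can be a leaf. Subtracting its contribution makes the
sequence vanish at 0 and 1 and leaves it unchanged for n > b, hence asymptotically. -/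
theorem childLeaves_of_le (hj : 1 ≤ j) (hjb : j ≤ b) {n : ℕ} (hn : n ≤ b) :
    childLeaves μ Ξ b j n = 0 := by
  simp [childLeaves, expectedLeaves, leafCount_of_le hj hjb hn]

theorem childLeaves_nonneg (hj : 1 ≤ j) (hjb : j ≤ b) (n : ℕ) : 0 ≤ childLeaves μ Ξ b j n := by
  rcases le_or_gt n b with hn | hn
  · rw [childLeaves_of_le hj hjb hn]
  · rw [childLeaves_of_lt hjb hn]
    exact expectedLeaves_nonneg n

theorem IsBernoulliStrings.abs_childLeaves_le (hΞ : IsBernoulliStrings μ p Ξ) (hj : 1 ≤ j)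
    (hjb : j ≤ b) (n : ℕ) : |childLeaves μ Ξ b j n| ≤ n := by
  rw [abs_of_nonneg (childLeaves_nonneg hj hjb n)]
  refine le_trans ?_ (hΞ.expectedLeaves_le hj hjb n)
  rw [childLeaves]
  split_ifs <;> simp

theorem IsBernoulliStrings.abs_childLeaves_succ_sub_le (hΞ : IsBernoulliStrings μ p Ξ)
    (hj : 1 ≤ j) (hjb : j ≤ b) (n : ℕ) :
    |childLeaves μ Ξ b j (n + 1) - childLeaves μ Ξ b j n| ≤ 3 := by
  have h := abs_le.1 (hΞ.abs_expectedLeaves_succ_sub_le hj hjb n)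
  simp only [childLeaves]
  rw [abs_le]
  split_ifs <;> constructor <;> linarith

theorem IsBernoulliStrings.poissonTransform_expectedLeaves (hΞ : IsBernoulliStrings μ p Ξ)
    (hj : 1 ≤ j) (hjb : j ≤ b) {x : ℝ} (hx : 0 ≤ x) :
    poissonTransform (expectedLeaves μ Ξ b j) x =
      poissonProb x j + poissonTransform (childLeaves μ Ξ b j) x := by
  have h1 : HasSum (fun n => poissonProb x n * if n = j then 1 else 0) (poissonProb x j) := by
    convert hasSum_ite_eq j (poissonProb x j) using 2 with n
    split_ifs with h <;> simp [h]
  rw [poissonTransform, poissonTransform, ← h1.tsum_eq,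
    ← h1.summable.tsum_add (summable_poissonProb_mul (hΞ.abs_childLeaves_le hj hjb) hx)]
  exact tsum_congr fun n => by rw [childLeaves]; ring

theorem IsBernoulliStrings.ofReal_poissonTransform (hΞ : IsBernoulliStrings μ p Ξ)
    (hj : 1 ≤ j) (hjb : j ≤ b) {x : ℝ} (hx : 0 ≤ x) :
    ∑' n, ENNReal.ofReal (poissonProb x n) * leafMean μ Ξ b j n =
      ENNReal.ofReal (poissonTransform (expectedLeaves μ Ξ b j) x) := by
  rw [poissonTransform, ENNReal.ofReal_tsum_of_nonneg]
  · refine tsum_congr fun n => ?_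
    rw [ENNReal.ofReal_mul (poissonProb_nonneg hx n), hΞ.ofReal_expectedLeaves hj hjb]
  · exact fun n => mul_nonneg (poissonProb_nonneg hx n) (expectedLeaves_nonneg n)
  · refine summable_poissonProb_mul (fun n => ?_) hx
    rw [abs_of_nonneg (expectedLeaves_nonneg n)]
    exact hΞ.expectedLeaves_le hj hjb n

theorem IsPoissonNumber.expectedLeavesRandom_eq_add {N : ℝ≥0 → Ω → ℕ}
    (hN : IsPoissonNumber μ Ξ N) (hΞ : IsBernoulliStrings μ p Ξ) (hj : 1 ≤ j) (hjb : j ≤ b)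
    (l : ℝ≥0) : expectedLeavesRandom μ Ξ b j (N l) =
      poissonProb l j + poissonTransform (childLeaves μ Ξ b j) l := by
  rw [hN.expectedLeavesRandom_eq hΞ hj hjb, hΞ.ofReal_poissonTransform hj hjb l.coe_nonneg,
    hΞ.poissonTransform_expectedLeaves hj hjb l.coe_nonneg, ENNReal.toReal_ofReal]
  exact add_nonneg (poissonProb_nonneg l.coe_nonneg j)
    (poissonTransform_nonneg (childLeaves_nonneg hj hjb) l.coe_nonneg)

theorem IsBernoulliStrings.ofReal_poissonTransform_childLeaves (hp : 0 < p) (hq : 0 < q)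
    (hpq : p + q = 1) (hΞ : IsBernoulliStrings μ p Ξ) (hj : 1 ≤ j) (hjb : j ≤ b) {x : ℝ}
    (hx : 0 ≤ x) : ENNReal.ofReal (poissonTransform (childLeaves μ Ξ b j) x) =
      ∑' β, ENNReal.ofReal (fLeaf p q b j (x * wordProb p q β)) := by
  have h1 := hΞ.tsum_poissonProb_mul_leafMean hp hq hpq hj hjb hx
  rw [hΞ.ofReal_poissonTransform hj hjb hx, hΞ.poissonTransform_expectedLeaves hj hjb hx,
    ENNReal.ofReal_add (poissonProb_nonneg hx j)
      (poissonTransform_nonneg (childLeaves_nonneg hj hjb) hx)] at h1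
  exact (ENNReal.add_right_inj ENNReal.ofReal_ne_top).1 h1

/-- In the sum over all words, the empty word contributes f_j(x), and the words starting with a
given letter reproduce the whole sum at px or qx. -/
theorem IsBernoulliStrings.poissonTransform_childLeaves_eq (hp : 0 < p) (hq : 0 < q)
    (hpq : p + q = 1) (hΞ : IsBernoulliStrings μ p Ξ) (hj : 1 ≤ j) (hjb : j ≤ b) {x : ℝ}
    (hx : 0 ≤ x) : poissonTransform (childLeaves μ Ξ b j) x = fLeaf p q b j x +
      (poissonTransform (childLeaves μ Ξ b j) (p * x) +
        poissonTransform (childLeaves μ Ξ b j) (q * x)) := by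
  have hn {y : ℝ} (hy : 0 ≤ y) : 0 ≤ poissonTransform (childLeaves μ Ξ b j) y :=
    poissonTransform_nonneg (childLeaves_nonneg hj hjb) hy
  have hpx : 0 ≤ p * x := by positivity
  have hqx : 0 ≤ q * x := by positivity
  have hf : 0 ≤ fLeaf p q b j x := fLeaf_nonneg hp hq hx
  rw [← ENNReal.ofReal_eq_ofReal_iff (hn hx) (add_nonneg hf (add_nonneg (hn hpx) (hn hqx))),
    ENNReal.ofReal_add hf (add_nonneg (hn hpx) (hn hqx)), ENNReal.ofReal_add (hn hpx) (hn hqx),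
    hΞ.ofReal_poissonTransform_childLeaves hp hq hpq hj hjb hx,
    hΞ.ofReal_poissonTransform_childLeaves hp hq hpq hj hjb hpx,
    hΞ.ofReal_poissonTransform_childLeaves hp hq hpq hj hjb hqx, tsum_list_cons]
  have e (r w : ℝ) : x * (r * w) = r * x * w := by ring
  simp [wordProb_cons, letterProb, e, show wordProb p q [] = 1 by simp [wordProb]]

end

/-! ### The renewal theorem for a two-point step distribution -/

/-- `h` is a bounded solution of the renewal equation `h = z + p h(· - A) + q h(· - B)`, and both
`z` at `∞` and `h` at `-∞` vanish. -/
structure RenewalSolution (p q A B M : ℝ) (z h : ℝ → ℝ) : Prop where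
  p_pos : 0 < p
  q_pos : 0 < q
  add_eq_one : p + q = 1
  eqn : ∀ t, h t = z t + p * h (t - A) + q * h (t - B)
  bound : ∀ t, |h t| ≤ M
  z_tendsto : Tendsto z atTop (𝓝 0)
  h_tendsto : Tendsto h atBot (𝓝 0)

namespace RenewalSolution

variable {p q A B M : ℝ} {z h : ℝ → ℝ}

theorem neg (H : RenewalSolution p q A B M z h) :
    RenewalSolution p q A B M (fun t => -z t) (fun t => -h t) where
  p_pos := H.p_pos
  q_pos := H.q_pos
  add_eq_one := H.add_eq_one
  eqn t := by rw [H.eqn t]; ring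
  bound t := by rw [abs_neg]; exact H.bound t
  z_tendsto := by simpa using H.z_tendsto.neg
  h_tendsto := by simpa using H.h_tendsto.neg

theorem swap (H : RenewalSolution p q A B M z h) : RenewalSolution q p B A M z h where
  p_pos := H.q_pos
  q_pos := H.p_pos
  add_eq_one := by rw [add_comm, H.add_eq_one]
  eqn t := by rw [H.eqn t]; ring
  bound := H.bound
  z_tendsto := H.z_tendsto
  h_tendsto := H.h_tendsto

theorem tendsto_diff_shift (H : RenewalSolution p q A B M z h) {ι : Type*} {l : Filter ι}
    {τ : ι → ℝ} (hτ : Tendsto τ l atTop) {L : ℝ}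
    (hL : ∀ c > L, ∀ᶠ t in atTop, h t - h (t - A) < c)
    (hu : Tendsto (fun i => h (τ i) - h (τ i - A)) l (𝓝 L)) :
    Tendsto (fun i => h (τ i - A) - h (τ i - A - A)) l (𝓝 L) := by
  have hp := H.p_pos
  have hq := H.q_pos
  have hpq := H.add_eq_one
  have hsub (c : ℝ) : Tendsto (fun i => τ i - c) l atTop := tendsto_atTop_add_const_right _ _ hτ
  rw [tendsto_order]
  refine ⟨fun c hc => ?_, fun c hc => (hsub A).eventually (hL c hc)⟩
  -- Three errors of size at most ε occur, from u(τ), from the source and from q u(τ - B); together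
  -- they cost 3ε = p(L - c).
  set ε := (L - c) * p / 3 with hε
  have hε0 : 0 < ε := by
    have := sub_pos.2 hc
    positivity
  have hw : Tendsto (fun i => z (τ i) - z (τ i - A)) l (𝓝 0) := by
    simpa using (H.z_tendsto.comp hτ).sub (H.z_tendsto.comp (hsub A))
  filter_upwards [hu.eventually (lt_mem_nhds (show L - ε < L by linarith)),
    hw.eventually (gt_mem_nhds hε0),
    (hsub B).eventually (hL (L + ε) (by linarith))] with i h1 h2 h3
  have e1 := H.eqn (τ i)
  have e2 := H.eqn (τ i - A)
  rw [sub_right_comm] at h3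
  have h4 : q * (h (τ i - B) - h (τ i - A - B)) ≤ q * (L + ε) :=
    mul_le_mul_of_nonneg_left h3.le hq.le
  have h5 : q * ε < ε := by nlinarith
  have h6 : p * c < p * (h (τ i - A) - h (τ i - A - A)) := by
    have : p * c = p * L - 3 * ε := by rw [hε]; ring
    have : q * L = L - p * L := by rw [← eq_sub_iff_add_eq'] at hpq; rw [hpq]; ring
    nlinarith
  exact lt_of_mul_lt_mul_left h6 hp.le

/-- If the limsup L of the differences were positive, then far out K consecutive differences at
spacing A would all be near L. They telescope to h(t) - h(t - KA) ≤ 2M, so KL ≤ 2M for every K, a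
contradiction. -/
theorem limsup_diff_le_zero (H : RenewalSolution p q A B M z h) {c : ℝ} (hc : 0 < c) :
    ∀ᶠ t in atTop, h t - h (t - A) < c := by
  set u := fun t => h t - h (t - A) with hu
  have hM (t) : |u t| ≤ 2 * M := (abs_sub _ _).trans (by linarith [H.bound t, H.bound (t - A)])
  have hb1 : IsBoundedUnder (· ≤ ·) atTop u :=
    isBoundedUnder_of ⟨2 * M, fun t => (abs_le.1 (hM t)).2⟩
  have hb2 : IsBoundedUnder (· ≥ ·) atTop u :=
    isBoundedUnder_of ⟨-(2 * M), fun t => (abs_le.1 (hM t)).1⟩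
  set L := limsup u atTop with hLdef
  have hL (c) (hc : c > L) : ∀ᶠ t in atTop, u t < c := eventually_lt_of_limsup_lt hc hb1
  suffices hL0 : L ≤ 0 from hL c (hL0.trans_lt hc)
  -- One ultrafilter attaining the limsup serves for all shifts, so no subsequences have to be
  -- extracted.
  obtain ⟨U, hU, hUL⟩ := mapClusterPt_iff_ultrafilter.1
    (MapClusterPt.limsup hb2.isCoboundedUnder_le hb1 : MapClusterPt L atTop u)
  have hshift (k : ℕ) : Tendsto (fun t => u (t - k * A)) U (𝓝 L) := by
    induction k with
    | zero => simpa using hUL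
    | succ k ih =>
      have := H.tendsto_diff_shift
        (tendsto_atTop_add_const_right _ (-(k * A)) (tendsto_id'.2 hU)) hL
        (by simpa [hu, sub_eq_add_neg] using ih)
      refine this.congr fun t => ?_
      simp only [hu, id]
      push_cast
      ring_nf
  have hsum (K : ℕ) : K * L ≤ 2 * M := by
    have h1 : Tendsto (fun t => ∑ k ∈ Finset.range K, u (t - k * A)) U (𝓝 (K * L)) := by
      simpa using tendsto_finsetSum (Finset.range K) fun k _ => hshift k
    refine le_of_tendsto h1 (Eventually.of_forall fun t => ?_)
    have h2 : ∑ k ∈ Finset.range K, u (t - k * A) = h t - h (t - K * A) := by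
      induction K with
      | zero => simp
      | succ K ih =>
        rw [Finset.sum_range_succ, ih]
        · simp only [hu]
          push_cast
          ring_nf
        · simpa using tendsto_finsetSum (Finset.range K) fun k _ => hshift k
    rw [h2]
    linarith [(abs_le.1 (H.bound t)).2, (abs_le.1 (H.bound (t - K * A))).1]
  by_contra! hL0
  obtain ⟨K, hK⟩ := exists_nat_gt (2 * M / L)
  rw [div_lt_iff₀ hL0] at hK
  linarith [hsum K]

theorem tendsto_diff (H : RenewalSolution p q A B M z h) :
    Tendsto (fun t => h t - h (t - A)) atTop (𝓝 0) := by
  rw [tendsto_order]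
  refine ⟨fun c hc => ?_, fun c hc => H.limsup_diff_le_zero hc⟩
  filter_upwards [H.neg.limsup_diff_le_zero (neg_pos.2 hc)] with t ht
  linarith

end RenewalSolution

/-- The asymptotic periods of a function at `∞`. -/
def asymptoticPeriods (h : ℝ → ℝ) : AddSubgroup ℝ where
  carrier := {s | Tendsto (fun t => h (t + s) - h t) atTop (𝓝 0)}
  zero_mem' := by simp
  add_mem' {r s} hr hs := by
    have h1 := (hr.comp (tendsto_atTop_add_const_right _ s tendsto_id)).add hs
    rw [add_zero] at h1
    refine h1.congr fun t => ?_
    simp only [Function.comp, id]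
    rw [add_assoc, add_comm s r]
    ring
  neg_mem' {s} hs := by
    have h1 := (hs.comp (tendsto_atTop_add_const_right _ (-s) tendsto_id)).neg
    rw [neg_zero] at h1
    refine h1.congr fun t => ?_
    simp

theorem mem_asymptoticPeriods {h : ℝ → ℝ} {s : ℝ} :
    s ∈ asymptoticPeriods h ↔ Tendsto (fun t => h (t + s) - h t) atTop (𝓝 0) := Iff.rfl

/-- Replacing s by a nearby period r changes h(t + s) by at most K|s - r|, uniformly in t. -/
theorem isClosed_asymptoticPeriods {h : ℝ → ℝ} {K : ℝ} (hK : ∀ s t, |h s - h t| ≤ K * |s - t|) :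
    IsClosed (asymptoticPeriods h : Set ℝ) := by
  have hK0 : 0 ≤ K := by simpa using (abs_nonneg _).trans (hK 1 0)
  refine isClosed_of_closure_subset fun s hs => ?_
  rw [SetLike.mem_coe, mem_asymptoticPeriods, Metric.tendsto_atTop']
  intro ε hε
  obtain ⟨r, hr, hrs⟩ := Metric.mem_closure_iff.1 hs (ε / (2 * (K + 1))) (by positivity)
  obtain ⟨T, hT⟩ := Metric.tendsto_atTop'.1 (mem_asymptoticPeriods.1 hr) (ε / 2) (by positivity)
  refine ⟨T, fun t ht => ?_⟩
  have h1 := hT t ht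
  have h2 := hK (t + s) (t + r)
  rw [Real.dist_eq, sub_zero] at h1 ⊢
  rw [Real.dist_eq, lt_div_iff₀ (by positivity)] at hrs
  rw [add_sub_add_left_eq_sub] at h2
  have h3 := abs_add_le (h (t + s) - h (t + r)) (h (t + r) - h t)
  rw [sub_add_sub_cancel] at h3
  nlinarith [abs_nonneg (s - r)]

namespace RenewalSolution

variable {p q A B M : ℝ} {z h : ℝ → ℝ}

theorem mem_asymptoticPeriods (H : RenewalSolution p q A B M z h) : A ∈ asymptoticPeriods h := by
  rw [← neg_mem_iff, _root_.mem_asymptoticPeriods]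
  simpa [sub_eq_add_neg] using H.tendsto_diff.neg

theorem mem_asymptoticPeriods_of_irrational (H : RenewalSolution p q A B M z h)
    (hAB : Irrational (A / B)) {K : ℝ} (hK : ∀ s t, |h s - h t| ≤ K * |s - t|) (s : ℝ) :
    s ∈ asymptoticPeriods h := by
  have h1 : AddSubgroup.closure {A, B} ≤ asymptoticPeriods h := by
    rw [AddSubgroup.closure_le]
    rintro x (rfl | rfl)
    exacts [H.mem_asymptoticPeriods, H.swap.mem_asymptoticPeriods]
  exact (isClosed_asymptoticPeriods hK).closure_subset_iff.2 h1
    (dense_addSubgroupClosure_pair_iff.2 hAB s)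

theorem hasDerivAt_window (hc : Continuous h) (A T : ℝ) :
    HasDerivAt (fun T => ∫ x in (T - A)..T, h x) (h T - h (T - A)) T := by
  have h1 (T) : ∫ x in (T - A)..T, h x = (∫ x in (0 : ℝ)..T, h x) - ∫ x in (0 : ℝ)..(T - A), h x := by
    rw [intervalIntegral.integral_interval_sub_left] <;> exact hc.intervalIntegrable _ _
  simp only [h1]
  have h2 (T) : HasDerivAt (fun T => ∫ x in (0 : ℝ)..T, h x) (h T) T :=
    intervalIntegral.integral_hasDerivAt_right (hc.intervalIntegrable _ _)
      (hc.stronglyMeasurableAtFilter _ _) hc.continuousAt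
  exact (h2 T).sub ((h2 (T - A)).comp_sub_const T A)

/-- The substitution x = T - s fixes the interval, and dominated convergence applies. It is used
with c = 0 at -∞ and with c = h at +∞. -/
theorem tendsto_window {l : Filter ℝ} [l.IsCountablyGenerated] (hb : ∀ t, |h t| ≤ M)
    (hc : Continuous h) {c : ℝ → ℝ} (hlim : ∀ s, Tendsto (fun t => h (t - s) - c t) l (𝓝 0))
    (hcb : ∀ t, |c t| ≤ M) (A : ℝ) :
    Tendsto (fun T => (∫ x in (T - A)..T, h x) - A * c T) l (𝓝 0) := by
  have h1 (T) : (∫ x in (T - A)..T, h x) - A * c T = ∫ s in (0 : ℝ)..A, (h (T - s) - c T) := by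
    rw [intervalIntegral.integral_sub, intervalIntegral.integral_comp_sub_left]
    · simp
    · exact (hc.comp (continuous_const.sub continuous_id)).intervalIntegrable _ _
    · exact intervalIntegrable_const
  simp only [h1]
  have h2 := intervalIntegral.tendsto_integral_filter_of_dominated_convergence (μ := volume)
    (a := 0) (b := A) (F := fun T s => h (T - s) - c T) (f := fun _ => 0) (l := l)
    (fun _ => 2 * M)
    (Eventually.of_forall fun T => by
      exact (((hc.comp (continuous_const.sub continuous_id))).sub
        continuous_const).aestronglyMeasurable)
    (Eventually.of_forall fun T => ae_of_all _ fun s _ =>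
      (abs_sub _ _).trans (by linarith [hb (T - s), hcb T]))
    intervalIntegrable_const (ae_of_all _ fun s _ => hlim s)
  simpa using h2

theorem tendsto_of_irrational (H : RenewalSolution p q A B M z h) (hA : 0 < A) (hB : 0 < B)
    (hAB : Irrational (A / B)) {K : ℝ} (hK : ∀ s t, |h s - h t| ≤ K * |s - t|)
    (hz : Integrable z) : Tendsto h atTop (𝓝 ((∫ t, z t) / (p * A + q * B))) := by
  have hp := H.p_pos
  have hq := H.q_pos
  have hM : 0 ≤ M := (abs_nonneg _).trans (H.bound 0)
  have hc : Continuous h := by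
    have hK0 : 0 ≤ K := by simpa using (abs_nonneg _).trans (hK 1 0)
    refine (LipschitzWith.of_dist_le_mul (K := ⟨K, hK0⟩) fun s t => ?_).continuous
    exact hK s t
  -- By the renewal equation and p + q = 1 the derivative of D is z, so D(T) is the integral of z up
  -- to T.
  set D := fun T => p * (∫ x in (T - A)..T, h x) + q * ∫ x in (T - B)..T, h x with hD
  have hder (T) : HasDerivAt D (z T) T := by
    have := ((hasDerivAt_window hc A T).const_mul p).add ((hasDerivAt_window hc B T).const_mul q)
    refine this.congr_deriv ?_
    have h1 := H.eqn T
    have h2 : p * h T + q * h T = h T := by rw [← add_mul, H.add_eq_one, one_mul]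
    linarith
  have hbot : Tendsto D atBot (𝓝 0) := by
    have h1 (A) := tendsto_window (c := fun _ => 0) H.bound hc (fun s => by
      simpa [sub_eq_add_neg, Function.comp_def] using
        H.h_tendsto.comp (tendsto_atBot_add_const_right _ (-s) tendsto_id)) (by simpa) A
    simpa using ((h1 A).const_mul p).add ((h1 B).const_mul q)
  have hDz (T) : ∫ x in Set.Iic T, z x = D T := by
    rw [integral_Iic_of_hasDerivAt_of_tendsto' (fun x _ => hder x) hz.integrableOn hbot, sub_zero]
  have htop : Tendsto D atTop (𝓝 (∫ t, z t)) := by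
    rw [← funext hDz]
    exact (aecover_Iic tendsto_id).integral_tendsto_of_countably_generated hz
  -- All shifts are asymptotic periods, so h is nearly constant on each window and D(T) is close to
  -- (pA + qB) h(T).
  have hw : Tendsto (fun T => D T - (p * A + q * B) * h T) atTop (𝓝 0) := by
    have h1 (A) := tendsto_window (c := h) (l := atTop) H.bound hc (fun s => by
      exact _root_.mem_asymptoticPeriods.1 (H.mem_asymptoticPeriods_of_irrational hAB hK (-s)))
      H.bound A
    have := ((h1 A).const_mul p).add ((h1 B).const_mul q)
    rw [mul_zero, mul_zero, add_zero] at this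
    refine this.congr fun T => ?_
    simp only [hD]
    ring
  have hH : 0 < p * A + q * B := by positivity
  have := (htop.sub hw).div_const (p * A + q * B)
  rw [sub_zero] at this
  refine this.congr fun T => ?_
  field_simp
  ring

/-- The discrete analogue of `tendsto_of_irrational`: windows become sums of m and l values of h at
spacing d, and the derivative becomes a difference with step d. The exponential bound on z makes the
lattice sums converge. -/
theorem tendsto_of_lattice (H : RenewalSolution p q A B M z h) {d : ℝ} {m l : ℕ}
    (hd : 0 < d) (hm : 0 < m) (hl : 0 < l) (hA : A = m * d) (hB : B = l * d)
    (hml : m.Coprime l) {C : ℝ} (hz : ∀ t, |z t| ≤ C * exp (-|t|)) :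
    Tendsto (fun t => h t - d / (p * A + q * B) * ∑' k : ℤ, z (t + k * d)) atTop (𝓝 0) := by
  have hp := H.p_pos
  have hq := H.q_pos
  have hdmem : d ∈ asymptoticPeriods h := by
    have hb := Nat.gcd_eq_gcd_ab m l
    rw [hml.gcd_eq_one] at hb
    -- Bézout for the coprime m and l puts d itself in the group of asymptotic periods.
    have e : d = m.gcdA l • A + m.gcdB l • B := by
      have hb' : (1 : ℝ) = m * m.gcdA l + l * m.gcdB l := by exact_mod_cast hb
      simp only [zsmul_eq_mul, hA, hB]
      linear_combination d * hb'
    rw [e]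
    exact add_mem (zsmul_mem H.mem_asymptoticPeriods _) (zsmul_mem H.swap.mem_asymptoticPeriods _)
  set W := fun (m : ℕ) (s : ℝ) => ∑ i ∈ Finset.range m, h (s - i * d) with hW
  have hWdiff (m : ℕ) (s : ℝ) : W m s - W m (s - d) = h s - h (s - m * d) := by
    simp only [hW]
    rw [← Finset.sum_sub_distrib]
    have := Finset.sum_range_sub' (fun i : ℕ => h (s - i * d)) m
    simp only [Nat.cast_zero, zero_mul, sub_zero] at this
    rw [← this]
    refine Finset.sum_congr rfl fun i _ => ?_
    push_cast
    ring_nf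
  have hWbot (m : ℕ) : Tendsto (W m) atBot (𝓝 0) := by
    simpa [hW, Function.comp_def, sub_eq_add_neg] using tendsto_finsetSum (Finset.range m) fun i _ =>
      H.h_tendsto.comp (tendsto_atBot_add_const_right _ (-(i * d)) tendsto_id)
  have hWtop (m : ℕ) : Tendsto (fun s => W m s - m * h s) atTop (𝓝 0) := by
    have := tendsto_finsetSum (Finset.range m) fun i _ =>
      _root_.mem_asymptoticPeriods.1 (neg_mem (nsmul_mem hdmem i))
    simpa [hW, Finset.sum_add_distrib, sub_eq_add_neg] using this
  set E := fun s => p * W m s + q * W l s with hE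
  have hEstep (s : ℝ) : E s - E (s - d) = z s := by
    have h1 := H.eqn s
    rw [hA, hB] at h1
    have h2 : p * h s + q * h s = h s := by rw [← add_mul, H.add_eq_one, one_mul]
    have h3 := hWdiff m s
    have h4 := hWdiff l s
    simp only [hE]
    linear_combination p * h3 + q * h4 + h1 + h2
  have hEbot : Tendsto E atBot (𝓝 0) := by
    simpa using ((hWbot m).const_mul p).add ((hWbot l).const_mul q)
  have hpos (s : ℝ) (k : ℕ) : |z (s + k * d)| ≤ C * exp (-s) * exp (-d) ^ k := by
    refine (hz _).trans ?_
    have hC : 0 ≤ C := by simpa using (abs_nonneg _).trans (hz 0)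
    rw [mul_assoc, ← exp_nat_mul, ← exp_add]
    refine mul_le_mul_of_nonneg_left (exp_le_exp.2 ?_) hC
    linarith [le_abs_self (s + k * d)]
  have hneg (s : ℝ) (k : ℕ) : |z (s - k * d)| ≤ C * exp s * exp (-d) ^ k := by
    refine (hz _).trans ?_
    have hC : 0 ≤ C := by simpa using (abs_nonneg _).trans (hz 0)
    rw [mul_assoc, ← exp_nat_mul, ← exp_add]
    refine mul_le_mul_of_nonneg_left (exp_le_exp.2 ?_) hC
    linarith [neg_abs_le (s - k * d)]
  have hgeom := hasSum_geometric_of_lt_one (exp_pos (-d)).le (exp_lt_one_iff.2 (neg_lt_zero.2 hd))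
  have hEsum (s : ℝ) : HasSum (fun k : ℕ => z (s - k * d)) (E s) := by
    have hs : Summable fun k : ℕ => z (s - k * d) :=
      .of_norm_bounded (hgeom.summable.mul_left _) (hneg s)
    rw [hs.hasSum_iff_tendsto_nat]
    have h1 (N : ℕ) : ∑ k ∈ Finset.range N, z (s - k * d) = E s - E (s - N * d) := by
      induction N with
      | zero => simp
      | succ N ih =>
        rw [Finset.sum_range_succ, ih, ← hEstep]
        push_cast
        ring_nf
    have h2 : Tendsto (fun N : ℕ => s - N * d) atTop atBot := by
      simp only [sub_eq_add_neg]
      exact tendsto_atBot_add_const_left _ _ (tendsto_neg_atTop_atBot.comp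
        (tendsto_natCast_atTop_atTop.atTop_mul_const hd))
    simp only [h1]
    simpa using tendsto_const_nhds.sub (hEbot.comp h2)
  -- E(s) sums z over s, s - d, s - 2d, …; the remaining terms s + d, s + 2d, … are negligible as s
  -- → ∞. The term z(s) lies in both half-sums and is subtracted once.
  have hG (s : ℝ) : ∑' k : ℤ, z (s + k * d) = ∑' k : ℕ, z (s + k * d) + (E s - z s) := by
    have h1 : HasSum (fun k : ℕ => z (s + (-((k : ℤ) + 1) : ℤ) * d)) (E s - z s) := by
      rw [← hEstep s, sub_sub_cancel]
      convert hEsum (s - d) using 3 with k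
      push_cast
      ring
    have h2 : Summable fun k : ℕ => z (s + k * d) :=
      .of_norm_bounded (hgeom.summable.mul_left _) (hpos s)
    have h3 := HasSum.of_nat_of_neg_add_one (f := fun k : ℤ => z (s + k * d))
      (by simpa using h2.hasSum) h1
    exact h3.tsum_eq
  have htail : Tendsto (fun s => ∑' k : ℕ, z (s + k * d)) atTop (𝓝 0) := by
    have h1 : Tendsto (fun s => C * exp (-s) * (1 - exp (-d))⁻¹) atTop (𝓝 0) := by
      simpa using (tendsto_exp_neg_atTop_nhds_zero.const_mul C).mul_const (1 - exp (-d))⁻¹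
    exact squeeze_zero_norm (fun s => tsum_of_norm_bounded (hgeom.mul_left _) (hpos s)) h1
  have hH : 0 < p * m + q * l := by
    have : (0 : ℝ) < m := by exact_mod_cast hm
    have : (0 : ℝ) < l := by exact_mod_cast hl
    positivity
  have hfin := ((((hWtop m).const_mul p).add ((hWtop l).const_mul q)).add
    (htail.sub H.z_tendsto)).div_const (-(p * m + q * l))
  simp only [mul_zero, add_zero, sub_zero, zero_div] at hfin
  refine hfin.congr fun s => ?_
  rw [hG, hA, hB]
  simp only [hE]
  generalize ∑' k : ℕ, z (s + k * d) = R
  field_simp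
  ring

end RenewalSolution

/-! ### Bounds for `f_j` and `g_j` -/

section

variable {p q : ℝ} {b j : ℕ}

theorem continuous_poissonProb (k : ℕ) : Continuous fun x => poissonProb x k := by
  unfold poissonProb
  fun_prop

theorem continuous_fLeaf : Continuous (fLeaf p q b j) := by
  have h (r : ℝ) (k : ℕ) : Continuous fun x => poissonProb (r * x) k :=
    (continuous_poissonProb k).comp (continuous_const_mul r)
  exact ((h p j).mul (continuous_const.sub (continuous_finsetSum _ fun k _ => h q k))).add
    ((h q j).mul (continuous_const.sub (continuous_finsetSum _ fun k _ => h p k)))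

theorem continuous_gLeaf : Continuous (gLeaf p q b j) :=
  continuous_exp.mul (continuous_fLeaf.comp (continuous_exp.comp continuous_neg))

theorem poissonProb_le_one {x : ℝ} (hx : 0 ≤ x) (k : ℕ) : poissonProb x k ≤ 1 := by
  simpa using sum_poissonProb_le_one hx {k}

theorem one_sub_le_of_poissonProb {x : ℝ} : 1 - poissonProb x 0 ≤ x := by
  have := add_one_le_exp (-x)
  simp only [poissonProb, pow_zero, Nat.factorial_zero, Nat.cast_one, mul_one, div_one]
  linarith

theorem poissonProb_le_self {x : ℝ} (hx : 0 ≤ x) {k : ℕ} (hk : 1 ≤ k) : poissonProb x k ≤ x := by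
  have h := sum_poissonProb_le_one hx {0, k}
  rw [Finset.sum_pair (by omega)] at h
  linarith [one_sub_le_of_poissonProb (x := x)]

theorem one_sub_sum_poissonProb_le {x : ℝ} (hx : 0 ≤ x) (n : ℕ) :
    1 - ∑ k ∈ Finset.range (n + 1), poissonProb x k ≤ x := by
  have := Finset.sum_le_sum_of_subset_of_nonneg (s := {0}) (t := Finset.range (n + 1))
    (f := poissonProb x) (by simp) (fun k _ _ => poissonProb_nonneg hx k)
  rw [Finset.sum_singleton] at this
  linarith [one_sub_le_of_poissonProb (x := x)]

theorem one_sub_sum_poissonProb_nonneg {x : ℝ} (hx : 0 ≤ x) (n : ℕ) :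
    0 ≤ 1 - ∑ k ∈ Finset.range (n + 1), poissonProb x k :=
  sub_nonneg.2 (sum_poissonProb_le_one hx _)

theorem one_sub_sum_poissonProb_le_one {x : ℝ} (hx : 0 ≤ x) (n : ℕ) :
    1 - ∑ k ∈ Finset.range (n + 1), poissonProb x k ≤ 1 :=
  sub_le_self _ (Finset.sum_nonneg fun k _ => poissonProb_nonneg hx k)

/-- Each summand is a product of two Poisson probabilities of events requiring at least one point (j
≥ 1), hence each factor is at most x. Together with `fLeaf_le_two` this gives exponential decay of
g_j at both ends. -/
theorem fLeaf_le_sq (hp : 0 < p) (hq : 0 < q) (hpq : p + q = 1) (hj : 1 ≤ j) {x : ℝ}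
    (hx : 0 ≤ x) : fLeaf p q b j x ≤ 2 * x ^ 2 := by
  have hpx : 0 ≤ p * x := by positivity
  have hqx : 0 ≤ q * x := by positivity
  have hpx' : p * x ≤ x := mul_le_of_le_one_left hx (by linarith)
  have hqx' : q * x ≤ x := mul_le_of_le_one_left hx (by linarith)
  have h1 := mul_le_mul ((poissonProb_le_self hpx hj).trans hpx')
    ((one_sub_sum_poissonProb_le hqx (b - j)).trans hqx')
    (one_sub_sum_poissonProb_nonneg hqx _) hx
  have h2 := mul_le_mul ((poissonProb_le_self hqx hj).trans hqx')
    ((one_sub_sum_poissonProb_le hpx (b - j)).trans hpx')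
    (one_sub_sum_poissonProb_nonneg hpx _) hx
  unfold fLeaf
  linarith

theorem fLeaf_le_two (hp : 0 < p) (hq : 0 < q) {x : ℝ}
    (hx : 0 ≤ x) : fLeaf p q b j x ≤ 2 := by
  have hpx : 0 ≤ p * x := by positivity
  have hqx : 0 ≤ q * x := by positivity
  have h1 := mul_le_mul (poissonProb_le_one hpx j) (one_sub_sum_poissonProb_le_one hqx (b - j))
    (one_sub_sum_poissonProb_nonneg hqx _) zero_le_one
  have h2 := mul_le_mul (poissonProb_le_one hqx j) (one_sub_sum_poissonProb_le_one hpx (b - j))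
    (one_sub_sum_poissonProb_nonneg hpx _) zero_le_one
  unfold fLeaf
  linarith

theorem abs_gLeaf_le (hp : 0 < p) (hq : 0 < q) (hpq : p + q = 1) (hj : 1 ≤ j) (t : ℝ) :
    |gLeaf p q b j t| ≤ 2 * exp (-|t|) := by
  have h0 : 0 ≤ fLeaf p q b j (exp (-t)) := fLeaf_nonneg hp hq (exp_pos _).le
  rw [gLeaf, abs_of_nonneg (mul_nonneg (exp_pos t).le h0)]
  rcases le_total 0 t with ht | ht
  · calc exp t * fLeaf p q b j (exp (-t)) ≤ exp t * (2 * exp (-t) ^ 2) := by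
          gcongr
          exact fLeaf_le_sq hp hq hpq hj (exp_pos _).le
      _ = 2 * exp (-|t|) := by
          rw [abs_of_nonneg ht, exp_neg]
          field_simp
  · calc exp t * fLeaf p q b j (exp (-t)) ≤ exp t * 2 := by
          gcongr
          exact fLeaf_le_two hp hq (exp_pos _).le
      _ = 2 * exp (-|t|) := by rw [abs_of_nonpos ht, neg_neg, mul_comm]

theorem integrable_exp_neg_abs : Integrable fun t : ℝ => exp (-|t|) := by
  rw [← integrableOn_univ, ← Set.Iic_union_Ioi (a := (0 : ℝ)), integrableOn_union]
  constructor
  · refine (integrableOn_exp_Iic 0).congr_fun (fun t ht => ?_) measurableSet_Iic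
    rw [abs_of_nonpos ht, neg_neg]
  · refine (exp_neg_integrableOn_Ioi 0 one_pos).congr_fun (fun t ht => ?_) measurableSet_Ioi
    simp [abs_of_pos (Set.mem_Ioi.1 ht)]

theorem integrable_gLeaf (hp : 0 < p) (hq : 0 < q) (hpq : p + q = 1) (hj : 1 ≤ j) :
    Integrable (gLeaf p q b j) :=
  (integrable_exp_neg_abs.const_mul 2).mono' continuous_gLeaf.aestronglyMeasurable
    (ae_of_all _ fun t => abs_gLeaf_le hp hq hpq hj t)

/-! ### Mellin transforms -/

theorem gHatLeaf_eq_fourier (s : ℝ) : gHatLeaf p q b j s =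
    FourierTransform.fourier (fun t => (gLeaf p q b j t : ℂ)) (s / (2 * π)) := by
  rw [Real.fourier_real_eq_integral_exp_smul, gHatLeaf]
  refine integral_congr_ae (ae_of_all _ fun t => ?_)
  simp only [smul_eq_mul]
  congr 2
  have : (π : ℂ) ≠ 0 := by exact_mod_cast pi_ne_zero
  push_cast
  field_simp

theorem gHatLeaf_eq_mellin (s : ℝ) : gHatLeaf p q b j s =
    mellin (fun x => (fLeaf p q b j x : ℂ)) (-1 + Complex.I * s) := by
  rw [gHatLeaf_eq_fourier, mellin_eq_fourier]
  simp [gLeaf]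

theorem gHatLeaf_eq_integral (s : ℝ) : gHatLeaf p q b j s =
    ∫ x in Set.Ioi (0 : ℝ), (fLeaf p q b j x : ℂ) * (x : ℂ) ^ (-2 + Complex.I * s) := by
  rw [gHatLeaf_eq_mellin, mellin]
  refine setIntegral_congr_fun measurableSet_Ioi fun x _ => ?_
  simp only [smul_eq_mul]
  rw [mul_comm]
  congr 2
  ring

theorem ofReal_cLeaf : (cLeaf p q b j : ℂ) = gHatLeaf p q b j 0 := by
  rw [cLeaf, gHatLeaf, ← integral_complex_ofReal]
  simp

theorem cLeaf_eq_integral : cLeaf p q b j = ∫ x in Set.Ioi (0 : ℝ), fLeaf p q b j x / x ^ 2 := by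
  have h : (cLeaf p q b j : ℂ) = ((∫ x in Set.Ioi (0 : ℝ), fLeaf p q b j x / x ^ 2 : ℝ) : ℂ) := by
    rw [ofReal_cLeaf, gHatLeaf_eq_integral, ← integral_complex_ofReal]
    refine setIntegral_congr_fun measurableSet_Ioi fun x _ => ?_
    simp [Complex.cpow_neg, div_eq_mul_inv]
  exact_mod_cast h

theorem hasMellin_pow_mul_exp {r : ℝ} (hr : 0 < r) {w : ℂ} {n : ℕ} (hw : 0 < (w + n).re) :
    HasMellin (fun x : ℝ => (x : ℂ) ^ n * (exp (-(r * x)) : ℂ)) w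
      ((r : ℂ) ^ (-(w + n)) * Complex.Gamma (w + n)) := by
  have h0 : MellinConvergent (fun x : ℝ => ((exp (-x) : ℝ) : ℂ)) (w + n) := by
    have := Complex.GammaIntegral_convergent hw
    simpa [MellinConvergent, mul_comm] using this
  have h1 := (MellinConvergent.comp_mul_left hr).2 h0
  have h2 := mellin_comp_mul_left (fun x : ℝ => ((exp (-x) : ℝ) : ℂ)) (w + n) hr
  have e : (fun x : ℝ => (x : ℂ) ^ n * (exp (-(r * x)) : ℂ)) =
      fun x : ℝ => (x : ℂ) ^ (n : ℂ) • ((exp (-(r * x)) : ℝ) : ℂ) := by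
    ext x
    simp
  rw [e]
  refine ⟨MellinConvergent.cpow_smul.2 h1, ?_⟩
  rw [mellin_cpow_smul, h2, Complex.Gamma_eq_integral hw, Complex.GammaIntegral_eq_mellin,
    smul_eq_mul]

theorem hasMellin_sum {ι : Type*} (s : Finset ι) {f : ι → ℝ → ℂ} {w : ℂ} {m : ι → ℂ}
    (h : ∀ i ∈ s, HasMellin (f i) w (m i)) :
    HasMellin (fun x => ∑ i ∈ s, f i x) w (∑ i ∈ s, m i) := by
  classical
  induction s using Finset.induction_on with
  | empty => simp [HasMellin, MellinConvergent, mellin]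
  | insert i s hi ih =>
    simp only [Finset.sum_insert hi]
    have h1 := h i (Finset.mem_insert_self i s)
    have h2 := ih fun k hk => h k (Finset.mem_insert_of_mem hk)
    have := hasMellin_add h1.1 h2.1
    rwa [h1.2, h2.2] at this

theorem HasMellin.const_mul {f : ℝ → ℂ} {w m : ℂ} (h : HasMellin f w m) (c : ℂ) :
    HasMellin (fun x => c * f x) w (c * m) :=
  ⟨h.1.const_smul c, by rw [← h.2]; exact mellin_const_smul f w c⟩

/-- The Gamma function formula for the Mellin transform of `f_j` at `-1 + z`. -/
noncomputable def mellinGamma (p q : ℝ) (b j : ℕ) (z : ℂ) : ℂ :=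
  Complex.Gamma ((j : ℂ) - 1 + z) / (j ! : ℂ) * ((p : ℂ) ^ (1 - z) + (q : ℂ) ^ (1 - z)) -
    ∑ k ∈ Finset.range (b - j + 1),
      Complex.Gamma ((j : ℂ) + k - 1 + z) / ((j ! : ℂ) * (k ! : ℂ)) *
        ((p : ℂ) ^ j * (q : ℂ) ^ k + (q : ℂ) ^ j * (p : ℂ) ^ k)

/-- Since e^{-px} e^{-qx} = e^{-x}, f_j is a finite combination of terms x^n e^{-rx} with n ≥ 1. The
condition Re z > 0 makes the Gamma integral of each of them converge; at Re z = 0 this fails for n =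
1. -/
theorem mellin_fLeaf (hp : 0 < p) (hq : 0 < q) (hpq : p + q = 1) (hj : 1 ≤ j) {z : ℂ}
    (hz : 0 < z.re) :
    mellin (fun x => (fLeaf p q b j x : ℂ)) (-1 + z) = mellinGamma p q b j z := by
  have hre (n : ℕ) (hn : 1 ≤ n) : 0 < (-1 + z + (n : ℂ)).re := by
    have : (1 : ℝ) ≤ n := by exact_mod_cast hn
    simp
    linarith
  have hterm (r : ℝ) (hr : 0 < r) : HasMellin
      (fun x : ℝ => (r : ℂ) ^ j / (j ! : ℂ) * ((x : ℂ) ^ j * (exp (-(r * x)) : ℂ))) (-1 + z)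
      (Complex.Gamma ((j : ℂ) - 1 + z) / (j ! : ℂ) * (r : ℂ) ^ (1 - z)) := by
    have h := (hasMellin_pow_mul_exp hr (hre j hj)).const_mul ((r : ℂ) ^ j / (j ! : ℂ))
    have hr' : (r : ℂ) ≠ 0 := by exact_mod_cast hr.ne'
    have e1 : (r : ℂ) ^ (1 - z) = (r : ℂ) ^ j * (r : ℂ) ^ (-(-1 + z + j)) := by
      rw [← Complex.cpow_natCast, ← Complex.cpow_add _ _ hr']
      congr 1
      ring
    have e2 : (j : ℂ) - 1 + z = -1 + z + j := by ring
    rw [e1, e2]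
    convert h using 1
    ring
  have hterm2 (k : ℕ) : HasMellin (fun x : ℝ => ((p : ℂ) ^ j * (q : ℂ) ^ k +
        (q : ℂ) ^ j * (p : ℂ) ^ k) / ((j ! : ℂ) * (k ! : ℂ)) *
        ((x : ℂ) ^ (j + k) * (exp (-(1 * x)) : ℂ))) (-1 + z)
      (Complex.Gamma ((j : ℂ) + k - 1 + z) / ((j ! : ℂ) * (k ! : ℂ)) *
        ((p : ℂ) ^ j * (q : ℂ) ^ k + (q : ℂ) ^ j * (p : ℂ) ^ k)) := by
    have h := (hasMellin_pow_mul_exp one_pos (hre (j + k) (by omega))).const_mul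
      (((p : ℂ) ^ j * (q : ℂ) ^ k + (q : ℂ) ^ j * (p : ℂ) ^ k) / ((j ! : ℂ) * (k ! : ℂ)))
    have e2 : (j : ℂ) + k - 1 + z = -1 + z + (j + k : ℕ) := by push_cast; ring
    rw [e2]
    convert h using 1
    simp only [Complex.ofReal_one, Complex.one_cpow, one_mul]
    ring
  have h1 := hasMellin_add (hterm p hp).1 (hterm q hq).1
  have h2 := hasMellin_sum (Finset.range (b - j + 1)) fun k _ => hterm2 k
  have h3 := hasMellin_sub h1.1 h2.1
  rw [h1.2, h2.2, (hterm p hp).2, (hterm q hq).2] at h3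
  rw [mellinGamma, mul_add, ← h3.2]
  congr 1
  ext x
  have hpois (k : ℕ) : poissonProb (p * x) j * poissonProb (q * x) k +
      poissonProb (q * x) j * poissonProb (p * x) k =
      (p ^ j * q ^ k + q ^ j * p ^ k) / (j ! * k !) * (x ^ (j + k) * exp (-(1 * x))) := by
    have : exp (-(1 * x)) = exp (-(p * x)) * exp (-(q * x)) := by
      rw [← exp_add, ← hpq]; ring_nf
    rw [this]
    simp only [poissonProb, mul_pow, pow_add]
    field_simp
  have hf : fLeaf p q b j x = p ^ j / j ! * (x ^ j * exp (-(p * x))) +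
      q ^ j / j ! * (x ^ j * exp (-(q * x))) - ∑ k ∈ Finset.range (b - j + 1),
        (p ^ j * q ^ k + q ^ j * p ^ k) / (j ! * k !) * (x ^ (j + k) * exp (-(1 * x))) := by
    simp only [← hpois, Finset.sum_add_distrib, ← Finset.mul_sum, fLeaf]
    simp only [poissonProb, mul_pow]
    ring
  rw [hf]
  push_cast
  ring

/-- The bounds O(1) at infinity and O(x²) at zero make the transform analytic for -2 < Re < 0, a
strip containing the line Re = -1. -/
theorem continuousAt_mellin_fLeaf (hp : 0 < p) (hq : 0 < q) (hpq : p + q = 1) (hj : 1 ≤ j)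
    (s : ℝ) : ContinuousAt (mellin fun x => (fLeaf p q b j x : ℂ)) (-1 + Complex.I * s) := by
  have hnorm {x : ℝ} (hx : 0 < x) : ‖(fLeaf p q b j x : ℂ)‖ = fLeaf p q b j x := by
    rw [Complex.norm_real, Real.norm_of_nonneg (fLeaf_nonneg hp hq hx.le)]
  refine (mellin_differentiableAt_of_isBigO_rpow (a := 0) (b := -2) ?_ ?_ ?_ ?_ ?_).continuousAt
  · exact ((Complex.continuous_ofReal.comp continuous_fLeaf).locallyIntegrable).locallyIntegrableOn _
  · refine Asymptotics.IsBigO.of_bound 2 ?_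
    filter_upwards [eventually_gt_atTop 0] with x hx
    rw [hnorm hx]
    simpa using fLeaf_le_two hp hq hx.le
  · simp
  · refine Asymptotics.IsBigO.of_bound 2 ?_
    filter_upwards [self_mem_nhdsWithin] with x hx
    rw [Set.mem_Ioi] at hx
    rw [hnorm hx]
    simpa using fLeaf_le_sq hp hq hpq hj hx.le
  · simp

theorem tendsto_mellinGamma (hp : 0 < p) (hq : 0 < q) (hpq : p + q = 1) (hj : 1 ≤ j) (s : ℝ) :
    Tendsto (fun ε : ℝ => mellinGamma p q b j (ε + Complex.I * s)) (𝓝[>] 0)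
      (𝓝 (gHatLeaf p q b j s)) := by
  rw [gHatLeaf_eq_mellin]
  have h1 : Tendsto (fun ε : ℝ => -1 + ((ε : ℂ) + Complex.I * s)) (𝓝[>] 0)
      (𝓝 (-1 + Complex.I * s)) := by
    have : Continuous fun ε : ℝ => -1 + ((ε : ℂ) + Complex.I * s) := by fun_prop
    simpa using (this.tendsto 0).mono_left nhdsWithin_le_nhds
  refine ((continuousAt_mellin_fLeaf hp hq hpq hj s).tendsto.comp h1).congr' ?_
  filter_upwards [self_mem_nhdsWithin] with ε hε
  exact mellin_fLeaf hp hq hpq hj (by simpa using hε)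

theorem continuousAt_Gamma_of_ne {z : ℂ} (hz : 0 < z.re ∨ z.re = 0 ∧ z.im ≠ 0) :
    ContinuousAt Complex.Gamma z := by
  refine (Complex.differentiableAt_Gamma z fun m h => ?_).continuousAt
  subst h
  rcases hz with h | ⟨-, h⟩
  · simp at h
    linarith [(Nat.cast_nonneg m : (0 : ℝ) ≤ m)]
  · simp at h

theorem continuousAt_ofReal_cpow_one_sub {r : ℝ} (hr : 0 < r) (z : ℂ) :
    ContinuousAt (fun z : ℂ => (r : ℂ) ^ (1 - z)) z :=
  (continuousAt_const_cpow (by exact_mod_cast hr.ne')).comp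
    (continuous_const.sub continuous_id).continuousAt

theorem gHatLeaf_eq_gHatGamma (hp : 0 < p) (hq : 0 < q) (hpq : p + q = 1) (hj : 1 ≤ j) {s : ℝ}
    (hs : ¬ (j = 1 ∧ s = 0)) : gHatLeaf p q b j s = gHatGamma p q b j s := by
  refine tendsto_nhds_unique (tendsto_mellinGamma hp hq hpq hj s) ?_
  have h1 : Tendsto (fun ε : ℝ => (ε : ℂ) + Complex.I * s) (𝓝[>] 0) (𝓝 (Complex.I * s)) := by
    have : Continuous fun ε : ℝ => (ε : ℂ) + Complex.I * s := by fun_prop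
    simpa using (this.tendsto 0).mono_left nhdsWithin_le_nhds
  have hre (k : ℕ) : ContinuousAt (fun z => Complex.Gamma ((j : ℂ) + k - 1 + z))
      (Complex.I * s) := by
    refine ContinuousAt.comp (continuousAt_Gamma_of_ne ?_)
      (continuous_const.add continuous_id).continuousAt
    have hj' : (1 : ℝ) ≤ j := by exact_mod_cast hj
    have hk : (0 : ℝ) ≤ k := by positivity
    -- The argument of Γ has zero real part only for j = 1, k = 0; then s ≠ 0 keeps it away from the
    -- pole.
    by_cases h : (j : ℝ) + k - 1 = 0
    · right
      have hj1 : (j : ℝ) = 1 := by linarith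
      refine ⟨by simpa using h, ?_⟩
      simpa using fun h0 => hs ⟨by exact_mod_cast hj1, h0⟩
    · left
      have : 0 < (j : ℝ) + k - 1 := lt_of_le_of_ne (by linarith) (Ne.symm h)
      simpa using this
  have hc : ContinuousAt (mellinGamma p q b j) (Complex.I * s) := by
    refine ContinuousAt.sub (((by simpa using hre 0 : ContinuousAt (fun z => Complex.Gamma
      ((j : ℂ) - 1 + z)) (Complex.I * s)).div_const _).mul
      ((continuousAt_ofReal_cpow_one_sub hp _).add (continuousAt_ofReal_cpow_one_sub hq _))) ?_
    exact tendsto_finsetSum _ fun k _ => ((hre k).div_const _).mul_const _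
  exact hc.tendsto.comp h1

end

/-! ### Explicit formulas for `c_j` -/

section

variable {p q : ℝ} {b j : ℕ}

theorem cLeaf_eq_of_two_le (hp : 0 < p) (hq : 0 < q) (hpq : p + q = 1) (hj : 2 ≤ j) :
    cLeaf p q b j =
      1 / ((j : ℝ) * ((j : ℝ) - 1)) - ∑ k ∈ Finset.range (b - j + 1), cTerm p q j k := by
  have hG (k : ℕ) : Complex.Gamma ((j : ℂ) + k - 1) = ((j + k - 2)! : ℝ) := by
    rw [show (j : ℂ) + k - 1 = ((j + k - 2 : ℕ) : ℂ) + 1 by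
      rw [Nat.cast_sub (by omega)]; push_cast; ring, Complex.Gamma_nat_eq_factorial]
    simp
  have hG0 := hG 0
  simp only [Nat.cast_zero, add_zero] at hG0
  have hf : (j ! : ℝ) = j * ((j : ℝ) - 1) * (j - 2)! := by
    obtain ⟨i, rfl⟩ := Nat.exists_eq_add_of_le' hj
    simp only [Nat.add_sub_cancel, Nat.factorial_succ]
    push_cast
    ring
  have h1 : ((j - 2)! : ℝ) / j ! = 1 / (j * ((j : ℝ) - 1)) := by
    rw [hf]
    field_simp
  have h : (cLeaf p q b j : ℂ) = ((1 / ((j : ℝ) * ((j : ℝ) - 1)) -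
      ∑ k ∈ Finset.range (b - j + 1), cTerm p q j k : ℝ) : ℂ) := by
    rw [ofReal_cLeaf, gHatLeaf_eq_gHatGamma hp hq hpq (by omega) (by omega), gHatGamma, ← h1]
    simp only [Complex.ofReal_zero, mul_zero, add_zero, sub_zero, Complex.cpow_one, hG, hG0, cTerm]
    rw [← Complex.ofReal_add, hpq]
    push_cast
    ring
  exact_mod_cast h

/-- At j = 1 the two terms with a pole at 0 combine, because p + q = 1, into Γ(1 + z)(y(z) - 1)/z,
where y(z) = p^{1-z} + q^{1-z}. Its limit is y'(0) = -p ln p - q ln q. -/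
theorem cLeaf_one (hp : 0 < p) (hq : 0 < q) (hpq : p + q = 1) :
    cLeaf p q b 1 = p * log (1 / p) + q * log (1 / q) -
      ∑ k ∈ Finset.Icc 1 (b - 1), 1 / (k : ℝ) * (p * q ^ k + q * p ^ k) := by
  set y : ℂ → ℂ := fun z => (p : ℂ) ^ (1 - z) + (q : ℂ) ^ (1 - z) with hy
  have hder1 {r : ℝ} (hr : 0 < r) :
      HasDerivAt (fun z : ℂ => (r : ℂ) ^ (1 - z)) ((-(r * log r) : ℝ) : ℂ) 0 := by
    have h := ((hasDerivAt_id (0 : ℂ)).const_sub 1).const_cpow (c := (r : ℂ))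
      (Or.inl (by exact_mod_cast hr.ne'))
    refine h.congr_deriv ?_
    simp [Complex.ofReal_log hr.le]
  have hder : HasDerivAt y ((-(p * log p) - q * log q : ℝ) : ℂ) 0 := by
    refine ((hder1 hp).add (hder1 hq)).congr_deriv ?_
    push_cast
    ring
  have hy0 : y 0 = 1 := by
    simp only [hy, sub_zero, Complex.cpow_one]
    exact_mod_cast hpq
  have hslope : Tendsto (fun z : ℂ => (y z - 1) / z) (𝓝[≠] 0)
      (𝓝 ((-(p * log p) - q * log q : ℝ) : ℂ)) := by
    refine hder.tendsto_slope.congr fun z => ?_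
    rw [slope_def_field, hy0, sub_zero]
  have hε : Tendsto (fun ε : ℝ => (ε : ℂ)) (𝓝[>] 0) (𝓝[≠] 0) := by
    refine tendsto_nhdsWithin_iff.2 ⟨?_, ?_⟩
    · have : Continuous fun ε : ℝ => (ε : ℂ) := by fun_prop
      simpa using (this.tendsto 0).mono_left nhdsWithin_le_nhds
    · filter_upwards [self_mem_nhdsWithin] with ε hε
      simpa using (Set.mem_Ioi.1 hε).ne'
  have hGc (k : ℕ) : Tendsto (fun z : ℂ => Complex.Gamma ((k : ℂ) + 1 + z)) (𝓝[≠] 0)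
      (𝓝 (Complex.Gamma ((k : ℂ) + 1))) := by
    have : ContinuousAt (fun z : ℂ => Complex.Gamma ((k : ℂ) + 1 + z)) 0 := by
      refine ContinuousAt.comp (continuousAt_Gamma_of_ne (Or.inl ?_))
        (continuous_const.add continuous_id).continuousAt
      simp
      positivity
    simpa using this.tendsto.mono_left nhdsWithin_le_nhds
  have hsplit {z : ℂ} (hz : z ≠ 0) : mellinGamma p q b 1 z =
      Complex.Gamma (((0 : ℕ) : ℂ) + 1 + z) * ((y z - 1) / z) - ∑ k ∈ Finset.range (b - 1),
        Complex.Gamma ((k : ℂ) + 1 + z) / ((k + 1)! : ℂ) *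
        ((p : ℂ) * (q : ℂ) ^ (k + 1) + (q : ℂ) * (p : ℂ) ^ (k + 1)) := by
    have h1 : Complex.Gamma (((0 : ℕ) : ℂ) + 1 + z) = z * Complex.Gamma z := by
      rw [Nat.cast_zero, zero_add, add_comm, Complex.Gamma_add_one z hz]
    have hpq' : (p : ℂ) + q = 1 := by exact_mod_cast hpq
    have h2 (k : ℕ) : (1 : ℂ) + (k + 1) - 1 + z = k + 1 + z := by ring
    rw [mellinGamma, Finset.sum_range_succ', h1]
    simp only [hy, Nat.cast_one, sub_self, zero_add, Nat.factorial_one, div_one, one_mul,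
      Nat.cast_add, h2, pow_one, Nat.cast_zero, add_zero, Nat.factorial_zero, pow_zero, mul_one,
      hpq']
    field_simp
    ring
  have hlim : Tendsto (mellinGamma p q b 1) (𝓝[≠] 0) (𝓝 (Complex.Gamma (((0 : ℕ) : ℂ) + 1) *
      ((-(p * log p) - q * log q : ℝ) : ℂ) - ∑ k ∈ Finset.range (b - 1),
        Complex.Gamma ((k : ℂ) + 1) / ((k + 1)! : ℂ) *
        ((p : ℂ) * (q : ℂ) ^ (k + 1) + (q : ℂ) * (p : ℂ) ^ (k + 1)))) := by
    refine (((hGc 0).mul hslope).sub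
      (tendsto_finsetSum _ fun k _ => ((hGc k).div_const _).mul_const _)).congr' ?_
    filter_upwards [self_mem_nhdsWithin] with z hz
    exact (hsplit hz).symm
  have h1 := tendsto_mellinGamma (b := b) hp hq hpq le_rfl 0
  simp only [Complex.ofReal_zero, mul_zero, add_zero] at h1
  have h2 := tendsto_nhds_unique h1 (hlim.comp hε)
  rw [← ofReal_cLeaf] at h2
  have h3 : (cLeaf p q b 1 : ℂ) = ((p * log (1 / p) + q * log (1 / q) -
      ∑ k ∈ Finset.Icc 1 (b - 1), 1 / (k : ℝ) * (p * q ^ k + q * p ^ k) : ℝ) : ℂ) := by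
    rw [h2, show Finset.Icc 1 (b - 1) = Finset.Ico (0 + 1) (b - 1 + 1) by ext; simp,
      ← Finset.sum_Ico_add' (fun k : ℕ => 1 / (k : ℝ) * (p * q ^ k + q * p ^ k)) 0 (b - 1) 1,
      ← Finset.range_eq_Ico, Complex.Gamma_nat_eq_factorial, one_div, one_div, log_inv, log_inv]
    simp only [Complex.Gamma_nat_eq_factorial, Nat.factorial_succ]
    push_cast
    congr 1
    · ring
    · refine Finset.sum_congr rfl fun k _ => ?_
      have : (k ! : ℂ) ≠ 0 := by exact_mod_cast k.factorial_ne_zero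
      have : (k : ℂ) + 1 ≠ 0 := by exact_mod_cast k.succ_ne_zero
      field_simp
  exact_mod_cast h3

/-- The leading part of each closed formula is the full series, and the subtracted finite sum is its
initial segment. The full series is the logarithmic one for j = 1 and the negative binomial one for
j ≥ 2, where the two letters give p/(j(j-1)) and q/(j(j-1)). -/
theorem hasSum_cTerm (hp : 0 < p) (hq : 0 < q) (hpq : p + q = 1) (hj : 1 ≤ j) (hjb : j ≤ b) :
    HasSum (fun m : ℕ => cTerm p q j (b - j + 1 + m)) (cLeaf p q b j) := by
  rcases hj.eq_or_lt with rfl | hj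
  · have hp1 : 1 - p = q := by linarith
    have hq1 : 1 - q = p := by linarith
    have hlog {r : ℝ} (hr : 0 < r) (hr1 : r < 1) :
        HasSum (fun n : ℕ => (1 - r) ^ (n + 1) / ((n : ℝ) + 1)) (-log r) := by
      have := hasSum_pow_div_log_of_abs_lt_one (x := 1 - r) (by rw [abs_lt]; constructor <;> linarith)
      simpa using this
    have h1 := ((hlog hp (by linarith)).mul_left p).add ((hlog hq (by linarith)).mul_left q)
    rw [← hasSum_nat_add_iff' (b - 1)] at h1
    have e1 : cLeaf p q b 1 = p * -log p + q * -log q - ∑ i ∈ Finset.range (b - 1),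
        (p * ((1 - p) ^ (i + 1) / ((i : ℝ) + 1)) + q * ((1 - q) ^ (i + 1) / ((i : ℝ) + 1))) := by
      rw [cLeaf_one hp hq hpq,
        show Finset.Icc 1 (b - 1) = Finset.Ico (0 + 1) (b - 1 + 1) by ext; simp,
        ← Finset.sum_Ico_add' (fun k : ℕ => 1 / (k : ℝ) * (p * q ^ k + q * p ^ k)) 0 (b - 1) 1,
        ← Finset.range_eq_Ico, one_div, one_div, log_inv, log_inv, hp1, hq1]
      congr 1
      refine Finset.sum_congr rfl fun k _ => ?_
      push_cast
      ring
    rw [e1]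
    refine h1.congr_eq fun m => ?_
    have e : b - 1 + 1 + m = (m + (b - 1)) + 1 := by omega
    rw [e, cTerm]
    generalize m + (b - 1) = n
    rw [show 1 + (n + 1) - 2 = n by omega, hp1, hq1, Nat.factorial_succ n]
    push_cast
    field_simp
    simp
  · have hgeo {r s : ℝ} (hr : 0 < r) (hs : 0 < s) (hrs : r + s = 1) :
        HasSum (fun k : ℕ => ((j + k - 2)! : ℝ) / (j ! * k !) * (r ^ j * s ^ k))
          (r * (1 / (j * ((j : ℝ) - 1)))) := by
      have h := (hasSum_choose_mul_geometric_of_norm_lt_one (j - 2) (r := s)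
        (by rw [Real.norm_of_nonneg hs.le]; linarith)).mul_left (r ^ j * ((j - 2)! / j !))
      obtain ⟨i, rfl⟩ := Nat.exists_eq_add_of_le' hj
      rw [show 1 - s = r by linarith] at h
      have e1 : r * (1 / (((i + 2 : ℕ) : ℝ) * (((i + 2 : ℕ) : ℝ) - 1))) =
          r ^ (i + 2) * ((i + 2 - 2)! / (i + 2)!) * (1 / r ^ (i + 2 - 2 + 1)) := by
        simp only [Nat.add_sub_cancel, Nat.factorial_succ]
        push_cast
        have : (i : ℝ) + 2 - 1 ≠ 0 := by linarith [(Nat.cast_nonneg i : (0 : ℝ) ≤ i)]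
        field_simp
        ring
      rw [e1]
      refine h.congr_eq fun k => ?_
      rw [Nat.cast_choose ℝ (by omega), Nat.add_sub_cancel, Nat.add_sub_cancel,
        show i + 2 + k - 2 = k + i by omega]
      field_simp
    have h1 := (hgeo hp hq hpq).add (hgeo hq hp (by linarith))
    rw [← add_mul, hpq, one_mul] at h1
    have h2 : HasSum (cTerm p q j) (1 / (j * ((j : ℝ) - 1))) :=
      h1.congr_eq fun k => by rw [cTerm]; ring
    rw [← hasSum_nat_add_iff' (b - j + 1), ← cLeaf_eq_of_two_le hp hq hpq hj] at h2
    exact h2.congr_eq fun m => by rw [add_comm]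

end

/-! ### The periodic limit function in the lattice case -/

theorem exists_bound_norm_Gamma (x : ℝ) (hx : 0 < x) :
    ∃ C, ∀ z : ℂ, z.re = x → ‖Complex.Gamma z‖ ≤ C := by
  refine ⟨∫ t in Set.Ioi (0 : ℝ), exp (-t) * t ^ (x - 1), fun z hz => ?_⟩
  rw [Complex.Gamma_eq_integral (by rwa [hz]), Complex.GammaIntegral]
  refine (norm_integral_le_integral_norm _).trans_eq
    (setIntegral_congr_fun measurableSet_Ioi fun t ht => ?_)
  rw [norm_mul, Complex.norm_cpow_eq_rpow_re_of_pos ht, Complex.norm_real,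
    Real.norm_of_nonneg (exp_pos _).le, Complex.sub_re, hz, Complex.one_re]

/-- Two steps of the functional equation lead to Γ(z + 2), which is bounded on vertical lines in the
right half-plane, and each factor z, z + 1 has norm at least |s|. Inverse square decay suffices for
absolutely summable Fourier coefficients. -/
theorem exists_bound_norm_Gamma_div_sq (n : ℕ) :
    ∃ C, ∀ s : ℝ, s ≠ 0 → ‖Complex.Gamma (n + Complex.I * s)‖ ≤ C / s ^ 2 := by
  obtain ⟨C, hC⟩ := exists_bound_norm_Gamma (n + 2) (by positivity)
  refine ⟨C, fun s hs => ?_⟩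
  set z : ℂ := n + Complex.I * s with hz
  have him : z.im = s := by simp [hz]
  have him1 : (z + 1).im = s := by simp [hz]
  have h0 : z ≠ 0 := fun h => hs (by rw [← him, h, Complex.zero_im])
  have h1 : z + 1 ≠ 0 := fun h => hs (by rw [← him1, h, Complex.zero_im])
  have h2 : Complex.Gamma (z + 1 + 1) = (z + 1) * (z * Complex.Gamma z) := by
    rw [Complex.Gamma_add_one _ h1, Complex.Gamma_add_one _ h0]
  have h3 := hC (z + 1 + 1) (by simp [hz]; ring)
  rw [h2, norm_mul, norm_mul, ← mul_assoc] at h3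
  have h4 : s ^ 2 ≤ ‖z + 1‖ * ‖z‖ := by
    rw [← sq_abs, pow_two]
    have e1 := Complex.abs_im_le_norm z
    have e2 := Complex.abs_im_le_norm (z + 1)
    rw [him] at e1
    rw [him1] at e2
    gcongr
  rw [le_div_iff₀ (by positivity), mul_comm]
  exact (mul_le_mul_of_nonneg_right h4 (norm_nonneg _)).trans h3

section

variable {p q : ℝ} {b j : ℕ}

theorem exists_bound_gHatLeaf (hp : 0 < p) (hq : 0 < q) (hpq : p + q = 1) (hj : 1 ≤ j) :
    ∃ C, ∀ s : ℝ, s ≠ 0 → ‖gHatLeaf p q b j s‖ ≤ C / s ^ 2 := by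
  choose C hC using exists_bound_norm_Gamma_div_sq
  refine ⟨C (j - 1) / j ! * 1 + ∑ k ∈ Finset.range (b - j + 1),
    C (j + k - 1) / (j ! * k !) * (p ^ j * q ^ k + q ^ j * p ^ k), fun s hs => ?_⟩
  have hnorm {r : ℝ} (hr : 0 < r) : ‖(r : ℂ) ^ (1 - Complex.I * s)‖ = r := by
    rw [Complex.norm_cpow_eq_rpow_re_of_pos hr]
    simp
  have hsum : ‖(p : ℂ) ^ (1 - Complex.I * s) + (q : ℂ) ^ (1 - Complex.I * s)‖ ≤ p + q :=
    (norm_add_le _ _).trans_eq (by rw [hnorm hp, hnorm hq])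
  have hG (k : ℕ) : ‖Complex.Gamma ((j : ℂ) + k - 1 + Complex.I * s)‖ ≤ C (j + k - 1) / s ^ 2 := by
    have := hC (j + k - 1) s hs
    rw [Nat.cast_sub (by omega)] at this
    push_cast at this
    exact this
  have hG0 := hG 0
  simp only [Nat.cast_zero, add_zero] at hG0
  rw [gHatLeaf_eq_gHatGamma hp hq hpq hj (fun h => hs h.2), gHatGamma, add_div, Finset.sum_div]
  refine (norm_sub_le _ _).trans (add_le_add ?_ ((norm_sum_le _ _).trans
    (Finset.sum_le_sum fun k _ => ?_)))
  · rw [norm_mul, norm_div, Complex.norm_natCast]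
    calc _ ≤ C (j - 1) / s ^ 2 / j ! * (p + q) :=
          mul_le_mul (div_le_div_of_nonneg_right hG0 (by positivity)) hsum (norm_nonneg _)
            (div_nonneg ((norm_nonneg _).trans hG0) (by positivity))
      _ = _ := by rw [hpq]; ring
  · rw [norm_mul, norm_div, norm_mul, Complex.norm_natCast, Complex.norm_natCast]
    have e : (p : ℂ) ^ j * (q : ℂ) ^ k + (q : ℂ) ^ j * (p : ℂ) ^ k =
        ((p ^ j * q ^ k + q ^ j * p ^ k : ℝ) : ℂ) := by push_cast; rfl
    rw [e, Complex.norm_real, Real.norm_of_nonneg (by positivity)]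
    calc _ ≤ C (j + k - 1) / s ^ 2 / (j ! * k !) * (p ^ j * q ^ k + q ^ j * p ^ k) := by
          gcongr
          exact hG k
      _ = _ := by ring

theorem summable_gHatLeaf (hp : 0 < p) (hq : 0 < q) (hpq : p + q = 1) (hj : 1 ≤ j) {d : ℝ}
    (hd : 0 < d) : Summable fun k : ℤ => gHatLeaf p q b j (-2 * π * k / d) := by
  obtain ⟨C, hC⟩ := exists_bound_gHatLeaf (b := b) hp hq hpq hj
  have h1 : Summable fun k : ℤ => C / (-2 * π / d) ^ 2 * (1 / (k : ℝ) ^ 2) :=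
    (Real.summable_one_div_int_pow.2 one_lt_two).mul_left _
  refine Summable.of_norm_bounded_eventually h1 ?_
  refine (Set.finite_singleton (0 : ℤ)).subset fun k hk => ?_
  by_contra hk0
  refine hk ?_
  have hk' : (k : ℝ) ≠ 0 := by exact_mod_cast hk0
  refine (hC (-2 * π * k / d) ?_).trans_eq ?_
  · have := pi_pos
    positivity
  · rw [show -2 * π * k / d = -2 * π / d * k by ring, mul_pow, div_mul_eq_div_div, div_eq_mul_one_div]

/-- The periodic function of the lattice case. -/
noncomputable def leafPeriodic (p q : ℝ) (b j : ℕ) (d t : ℝ) : ℝ :=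
  d / letterEntropy p q * ∑' k : ℤ, gLeaf p q b j (-(t + k * d))

theorem fourier_gLeaf_comp {d : ℝ} (hd : 0 < d) (k : ℤ) :
    FourierTransform.fourier (fun x : ℝ => (gLeaf p q b j (-(d * x)) : ℂ)) k =
      (d : ℂ)⁻¹ * gHatLeaf p q b j (-2 * π * k / d) := by
  have h := Measure.integral_comp_mul_left (fun t : ℝ => Complex.exp (-Complex.I *
    (-2 * π * k / d : ℝ) * t) * (gLeaf p q b j t : ℂ)) (-d)
  rw [abs_inv, abs_neg, abs_of_pos hd] at h
  have hd' : (d : ℂ) ≠ 0 := by exact_mod_cast hd.ne'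
  rw [gHatLeaf, Real.fourier_real_eq_integral_exp_smul, ← Complex.ofReal_inv, ← Complex.real_smul,
    ← h]
  refine integral_congr_ae (ae_of_all _ fun x => ?_)
  simp only [smul_eq_mul, neg_mul]
  congr 2
  push_cast
  field_simp

/-- Poisson summation for x ↦ g_j(-dx), evaluated at t/d. -/
theorem hasSum_leafPeriodic (hp : 0 < p) (hq : 0 < q) (hpq : p + q = 1) (hj : 1 ≤ j) {d : ℝ}
    (hd : 0 < d) (t : ℝ) : HasSum
      (fun k : ℤ => (letterEntropy p q : ℂ)⁻¹ * gHatLeaf p q b j (-2 * π * k / d) *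
        Complex.exp (2 * π * Complex.I * k * t / d)) (leafPeriodic p q b j d t : ℂ) := by
  have hd' : (d : ℂ) ≠ 0 := by exact_mod_cast hd.ne'
  have hcont : Continuous fun x : ℝ => (gLeaf p q b j (-(d * x)) : ℂ) :=
    Complex.continuous_ofReal.comp (continuous_gLeaf.comp (continuous_const_mul d).neg)
  have hdecay : (fun x : ℝ => (gLeaf p q b j (-(d * x)) : ℂ)) =O[cocompact ℝ]
      fun x => |x| ^ (-2 : ℝ) := by
    -- The constant comes from e^{-y} ≤ 2/y² with y = d|x|, times the factor 2 in `abs_gLeaf_le`;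
    -- only x = 0 is excluded.
    refine Asymptotics.IsBigO.of_bound (4 / d ^ 2) (Eventually.mono
      (isCompact_singleton (x := (0 : ℝ))).compl_mem_cocompact fun x hx => ?_)
    have hx0 : 0 < |x| := abs_pos.2 hx
    have hy : 0 < d * |x| := by positivity
    rw [Complex.norm_real, Real.norm_eq_abs, Real.norm_of_nonneg (by positivity), rpow_neg hx0.le,
      Real.rpow_two]
    refine (abs_gLeaf_le hp hq hpq hj _).trans ?_
    rw [abs_neg, abs_mul, abs_of_pos hd, exp_neg]
    have h1 : (d * |x|) ^ 2 / 2 ≤ exp (d * |x|) := by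
      linarith [quadratic_le_exp_of_nonneg hy.le]
    calc 2 * (exp (d * |x|))⁻¹ ≤ 2 * ((d * |x|) ^ 2 / 2)⁻¹ := by gcongr
      _ = 4 / d ^ 2 * (|x| ^ 2)⁻¹ := by
        field_simp
        norm_num
  have hsum := summable_gHatLeaf (b := b) hp hq hpq hj hd
  have hsumF : Summable fun k : ℤ =>
      FourierTransform.fourier (fun x : ℝ => (gLeaf p q b j (-(d * x)) : ℂ)) k := by
    simp only [fourier_gLeaf_comp hd]
    exact hsum.mul_left _
  have hP := Real.tsum_eq_tsum_fourier_of_rpow_decay_of_summable hcont one_lt_two hdecay hsumF (t / d)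
  have hterm (k : ℤ) : (letterEntropy p q : ℂ)⁻¹ * gHatLeaf p q b j (-2 * π * k / d) *
        Complex.exp (2 * π * Complex.I * k * t / d) = (d / letterEntropy p q : ℂ) *
      (FourierTransform.fourier (fun x : ℝ => (gLeaf p q b j (-(d * x)) : ℂ)) k *
        fourier k ((t / d : ℝ) : UnitAddCircle)) := by
    rw [fourier_gLeaf_comp hd, fourier_coe_apply]
    have : 2 * π * Complex.I * k * t / d = 2 * π * Complex.I * k * ((t / d : ℝ) : ℂ) / (1 : ℝ) := by
      push_cast; ring
    rw [this]
    field_simp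
  have hval : (leafPeriodic p q b j d t : ℂ) = (d / letterEntropy p q : ℂ) *
      ∑' k : ℤ, (gLeaf p q b j (-(d * (t / d + k))) : ℂ) := by
    rw [leafPeriodic]
    push_cast
    congr 1
    refine tsum_congr fun k => ?_
    congr 3
    field_simp
  rw [hval, hP]
  simp only [hterm]
  refine (Summable.hasSum ?_).mul_left _
  refine Summable.of_norm_bounded hsumF.norm fun k => ?_
  rw [norm_mul, fourier_apply, Circle.norm_coe, mul_one]

theorem leafPeriodic_periodic (d : ℝ) : Function.Periodic (leafPeriodic p q b j d) d := by
  intro t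
  rw [leafPeriodic, leafPeriodic,
    ← (Equiv.addRight (1 : ℤ)).tsum_eq fun k : ℤ => gLeaf p q b j (-(t + k * d))]
  congr 1
  refine tsum_congr fun k => ?_
  simp only [Equiv.coe_addRight]
  push_cast
  ring_nf

theorem norm_exp_two_pi_mul (k : ℤ) (t d : ℝ) :
    ‖Complex.exp (2 * π * Complex.I * k * t / d)‖ = 1 := by
  have : 2 * π * Complex.I * k * t / d = ((2 * π * k * t / d : ℝ) : ℂ) * Complex.I := by
    push_cast; ring
  rw [this, Complex.norm_exp_ofReal_mul_I]

theorem summable_norm_leafPeriodic (hp : 0 < p) (hq : 0 < q) (hpq : p + q = 1) (hj : 1 ≤ j)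
    {d : ℝ} (hd : 0 < d) : Summable fun k : ℤ =>
      ‖(letterEntropy p q : ℂ)⁻¹ * gHatLeaf p q b j (-2 * π * k / d)‖ :=
  ((summable_gHatLeaf hp hq hpq hj hd).mul_left _).norm

theorem continuous_leafPeriodic (hp : 0 < p) (hq : 0 < q) (hpq : p + q = 1) (hj : 1 ≤ j)
    {d : ℝ} (hd : 0 < d) : Continuous (leafPeriodic p q b j d) := by
  have h : Continuous fun t => (leafPeriodic p q b j d t : ℂ) := by
    simp only [← fun t => (hasSum_leafPeriodic (b := b) hp hq hpq hj hd t).tsum_eq]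
    refine continuous_tsum (fun k => by fun_prop)
      (summable_norm_leafPeriodic (b := b) hp hq hpq hj hd) fun k t => ?_
    rw [norm_mul, norm_exp_two_pi_mul, mul_one]
  simpa [Function.comp_def] using Complex.continuous_re.comp h

/-- Integrating the Fourier series termwise over one period leaves only k = 0, whose coefficient is
c_j/H. -/
theorem integral_leafPeriodic (hp : 0 < p) (hq : 0 < q) (hpq : p + q = 1) (hj : 1 ≤ j)
    {d : ℝ} (hd : 0 < d) : (1 / d) * (∫ t in (0 : ℝ)..d, leafPeriodic p q b j d t) =
      cLeaf p q b j / letterEntropy p q := by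
  have hd' : (d : ℂ) ≠ 0 := by exact_mod_cast hd.ne'
  have hpi : (π : ℂ) ≠ 0 := by exact_mod_cast pi_ne_zero
  have hs := summable_norm_leafPeriodic (b := b) hp hq hpq hj hd
  have h1 := intervalIntegral.hasSum_integral_of_dominated_convergence (μ := volume) (a := 0)
    (b := d) (F := fun (k : ℤ) (t : ℝ) =>
      (letterEntropy p q : ℂ)⁻¹ * gHatLeaf p q b j (-2 * π * k / d) *
        Complex.exp (2 * π * Complex.I * k * t / d))
    (f := fun t => (leafPeriodic p q b j d t : ℂ))
    (fun k _ => ‖(letterEntropy p q : ℂ)⁻¹ * gHatLeaf p q b j (-2 * π * k / d)‖)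
    (fun k => by
      have : Continuous fun t : ℝ => (letterEntropy p q : ℂ)⁻¹ *
        gHatLeaf p q b j (-2 * π * k / d) * Complex.exp (2 * π * Complex.I * k * t / d) := by
        fun_prop
      exact this.aestronglyMeasurable)
    (fun k => ae_of_all _ fun t _ => by rw [norm_mul, norm_exp_two_pi_mul, mul_one])
    (ae_of_all _ fun t _ => hs) intervalIntegrable_const
    (ae_of_all _ fun t _ => hasSum_leafPeriodic hp hq hpq hj hd t)
  have hint (k : ℤ) (hk : k ≠ 0) : ∫ t in (0 : ℝ)..d,
      (letterEntropy p q : ℂ)⁻¹ * gHatLeaf p q b j (-2 * π * k / d) *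
        Complex.exp (2 * π * Complex.I * k * t / d) = 0 := by
    have hc : 2 * π * Complex.I * k / d ≠ 0 := by
      have : (k : ℂ) ≠ 0 := by exact_mod_cast hk
      simp [hpi, this, hd', Complex.I_ne_zero]
    have e (t : ℝ) : 2 * π * Complex.I * k * t / d = 2 * π * Complex.I * k / d * t := by ring
    simp only [e]
    rw [intervalIntegral.integral_const_mul, integral_exp_mul_complex hc]
    have e2 : 2 * π * Complex.I * k / d * d = k * (2 * π * Complex.I) := by field_simp
    rw [e2, Complex.exp_int_mul_two_pi_mul_I]
    simp
  have h2 := h1.unique (hasSum_single 0 fun k hk => hint k hk)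
  rw [intervalIntegral.integral_ofReal] at h2
  simp only [Int.cast_zero, mul_zero, zero_mul, zero_div, Complex.exp_zero,
    mul_one, intervalIntegral.integral_const, sub_zero, ← ofReal_cLeaf] at h2
  have h3 : (∫ t in (0 : ℝ)..d, leafPeriodic p q b j d t) =
      d * ((letterEntropy p q)⁻¹ * cLeaf p q b j) := by
    have h4 : ((∫ t in (0 : ℝ)..d, leafPeriodic p q b j d t : ℝ) : ℂ) =
        ((d * ((letterEntropy p q)⁻¹ * cLeaf p q b j) : ℝ) : ℂ) := by
      rw [h2]
      simp
    exact_mod_cast h4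
  rw [h3]
  field_simp

end

/-! ### The common divisor of two logarithms -/

/-- Write ln p / ln q as a reduced fraction m/l and take d = -ln q / l. For another common divisor
e, with ln p = m'e and ln q = l'e, coprimality in m l' = m' l forces l ∣ l', so d is a positive
multiple of e. -/
theorem exists_isGreatest_commonLogDivisors {p q : ℝ} (hp : 0 < p) (hq : 0 < q)
    (hpq : p + q = 1) (h : ¬ Irrational (log p / log q)) :
    ∃ d, ∃ m l : ℕ, IsGreatest (commonLogDivisors p q) d ∧ 0 < d ∧ 0 < m ∧ 0 < l ∧
      -log p = m * d ∧ -log q = l * d ∧ m.Coprime l := by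
  have hlp : log p < 0 := log_neg hp (by linarith)
  have hlq : log q < 0 := log_neg hq (by linarith)
  have hlq0 := hlq.ne
  rw [Irrational, not_not] at h
  obtain ⟨r, hr⟩ := h
  have hr0 : 0 < r := by
    have : (0 : ℝ) < r := by rw [hr]; exact div_pos_of_neg_of_neg hlp hlq
    exact_mod_cast this
  have hnum : 0 < r.num := Rat.num_pos.2 hr0
  have hm : ((r.num.natAbs : ℕ) : ℝ) = r.num := by
    rw [Nat.cast_natAbs, abs_of_pos hnum]
  have hden : (0 : ℝ) < r.den := by exact_mod_cast r.den_pos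
  have hr' : (r : ℝ) = r.num / r.den := by exact_mod_cast (Rat.num_div_den r).symm
  set d := -log q / r.den with hd
  have hd0 : 0 < d := div_pos (by linarith) hden
  have hqd : -log q = r.den * d := by rw [hd]; field_simp
  have hpd : -log p = r.num.natAbs * d := by
    have : log p = r * log q := by rw [hr]; field_simp
    rw [hm, this, hd, hr']
    ring
  refine ⟨d, r.num.natAbs, r.den, ⟨⟨hd0, ⟨-r.num, ?_⟩, ⟨-r.den, ?_⟩⟩, ?_⟩, hd0,
    Int.natAbs_pos.2 hnum.ne', r.den_pos, hpd, hqd, r.reduced⟩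
  · push_cast
    rw [← hm]
    linarith
  · push_cast
    linarith
  · rintro e ⟨he, ⟨m', hm'⟩, ⟨l', hl'⟩⟩
    have hl0 : l' < 0 := by
      by_contra! h
      have : (0 : ℝ) ≤ l' := by exact_mod_cast h
      have : 0 ≤ l' * e := by positivity
      linarith
    have h1 : r.num * l' = m' * r.den := by
      have : (r.num * l' : ℝ) * (e * d) = m' * r.den * (e * d) := by
        have e1 : (r.num : ℝ) * d = -(m' * e) := by rw [← hm, ← hpd, hm']
        have e2 : (r.den : ℝ) * d = -(l' * e) := by rw [← hqd, hl']
        linear_combination l' * e * e1 - m' * e * e2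
      have := mul_right_cancel₀ (by positivity) this
      exact_mod_cast this
    have h2 : (r.den : ℤ) ∣ l' := by
      have : (r.den : ℤ) ∣ r.num * l' := ⟨m', by rw [h1, mul_comm]⟩
      exact (Int.isCoprime_iff_gcd_eq_one.2 (by simpa [Int.gcd] using r.reduced.symm)).dvd_of_dvd_mul_left this
    obtain ⟨k, rfl⟩ := h2
    have hk : k ≤ -1 := by
      have : (0 : ℤ) < r.den := by exact_mod_cast r.den_pos
      have : k < 0 := by
        by_contra! h
        have := mul_nonneg this.le h
        omega
      omega
    have hk' : (k : ℝ) ≤ -1 := by exact_mod_cast hk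
    have h3 : d = -k * e := by
      rw [hd, hl']
      push_cast
      field_simp
    rw [h3]
    nlinarith

/-! ### Asymptotics of the expected number of leaves -/

/-- `e^{-t} φ(e^t)`, where `φ` is the Poisson transform of the expected number of leaves. -/
noncomputable def leafDensity {Ω : Type*} [MeasurableSpace Ω] (μ : Measure Ω)
    (Ξ : ℕ → Ω → ℕ → Bool) (b j : ℕ) (t : ℝ) : ℝ :=
  exp (-t) * poissonTransform (childLeaves μ Ξ b j) (exp t)

theorem tendsto_two_mul_exp_neg_abs : Tendsto (fun t : ℝ => 2 * exp (-|t|)) atTop (𝓝 0) := by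
  simpa using (tendsto_exp_neg_atTop_nhds_zero.comp tendsto_abs_atTop_atTop).const_mul 2

section

variable {Ω : Type*} [MeasurableSpace Ω] {μ : Measure Ω}
  {p q : ℝ} {Ξ : ℕ → Ω → ℕ → Bool} {b j : ℕ}

theorem leafDensity_log {x : ℝ} (hx : 0 < x) :
    leafDensity μ Ξ b j (log x) = poissonTransform (childLeaves μ Ξ b j) x / x := by
  rw [leafDensity, exp_log hx, exp_neg, exp_log hx]
  ring

variable [IsProbabilityMeasure μ]

theorem leafDensity_nonneg (hj : 1 ≤ j) (hjb : j ≤ b) (t : ℝ) : 0 ≤ leafDensity μ Ξ b j t :=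
  mul_nonneg (exp_pos _).le (poissonTransform_nonneg (childLeaves_nonneg hj hjb) (exp_pos t).le)

theorem IsBernoulliStrings.leafDensity_le_one (hΞ : IsBernoulliStrings μ p Ξ) (hj : 1 ≤ j)
    (hjb : j ≤ b) (t : ℝ) : leafDensity μ Ξ b j t ≤ 1 := by
  calc leafDensity μ Ξ b j t ≤ exp (-t) * exp t :=
        mul_le_mul_of_nonneg_left
          (poissonTransform_le (hΞ.abs_childLeaves_le hj hjb) (exp_pos t).le) (exp_pos _).le
    _ = 1 := by rw [← exp_add, neg_add_cancel, exp_zero]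

theorem IsBernoulliStrings.leafDensity_le_exp (hΞ : IsBernoulliStrings μ p Ξ) (hj : 1 ≤ j)
    (hjb : j ≤ b) (t : ℝ) : leafDensity μ Ξ b j t ≤ exp t := by
  calc leafDensity μ Ξ b j t ≤ exp (-t) * exp t ^ 2 :=
        mul_le_mul_of_nonneg_left (poissonTransform_le_sq (hΞ.abs_childLeaves_le hj hjb)
          (childLeaves_of_le hj hjb (by omega)) (exp_pos t).le) (exp_pos _).le
    _ = exp t := by
      rw [exp_neg]
      field_simp

theorem IsBernoulliStrings.renewalSolution (hp : 0 < p) (hq : 0 < q) (hpq : p + q = 1)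
    (hΞ : IsBernoulliStrings μ p Ξ) (hj : 1 ≤ j) (hjb : j ≤ b) :
    RenewalSolution p q (-log p) (-log q) 1 (fun t => gLeaf p q b j (-t))
      (leafDensity μ Ξ b j) where
  p_pos := hp
  q_pos := hq
  add_eq_one := hpq
  eqn t := by
    have h := hΞ.poissonTransform_childLeaves_eq hp hq hpq hj hjb (exp_pos t).le
    have e {r : ℝ} (hr : 0 < r) : r * leafDensity μ Ξ b j (t - -log r) =
        exp (-t) * poissonTransform (childLeaves μ Ξ b j) (r * exp t) := by
      rw [leafDensity, sub_neg_eq_add, neg_add, exp_add, exp_add, exp_neg (log r), exp_log hr,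
        mul_comm (exp t) r]
      field_simp
    rw [e hp, e hq, leafDensity, h, gLeaf, neg_neg]
    ring
  bound t := by
    rw [abs_of_nonneg (leafDensity_nonneg hj hjb t)]
    exact hΞ.leafDensity_le_one hj hjb t
  z_tendsto := by
    refine squeeze_zero_norm (fun t => ?_) tendsto_two_mul_exp_neg_abs
    have := abs_gLeaf_le (b := b) hp hq hpq hj (-t)
    rwa [abs_neg] at this
  h_tendsto := squeeze_zero (fun t => leafDensity_nonneg hj hjb t)
    (fun t => hΞ.leafDensity_le_exp hj hjb t) tendsto_exp_atBot

theorem IsBernoulliStrings.abs_leafDensity_sub_le (hΞ : IsBernoulliStrings μ p Ξ) (hj : 1 ≤ j)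
    (hjb : j ≤ b) (s t : ℝ) :
    |leafDensity μ Ξ b j s - leafDensity μ Ξ b j t| ≤ 4 * |s - t| := by
  wlog h : s ≤ t generalizing s t
  · rw [abs_sub_comm, abs_sub_comm s]
    exact this t s (le_of_not_ge h)
  have h1 := abs_poissonTransform_sub_le (hΞ.abs_childLeaves_le hj hjb)
    (hΞ.abs_childLeaves_succ_sub_le hj hjb) (exp_pos s).le (exp_pos t).le
  have h2 := leafDensity_nonneg (μ := μ) (Ξ := Ξ) hj hjb s
  have h3 := hΞ.leafDensity_le_one hj hjb s
  have h4 : exp (s - t) ≤ 1 := exp_le_one_iff.2 (by linarith)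
  have h5 := add_one_le_exp (s - t)
  have h6 : exp s ≤ exp t := exp_le_exp.2 h
  -- Separate the change of the factor e^{-t} from that of the transform. The first contributes
  -- Lipschitz constant 1, since the density is at most 1, and the second 3, the increment bound for
  -- `childLeaves`.
  have e : leafDensity μ Ξ b j s - leafDensity μ Ξ b j t =
      leafDensity μ Ξ b j s * (1 - exp (s - t)) + exp (-t) *
        (poissonTransform (childLeaves μ Ξ b j) (exp s) -
          poissonTransform (childLeaves μ Ξ b j) (exp t)) := by
    have : exp (-s) * exp (s - t) = exp (-t) := by rw [← exp_add]; ring_nf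
    simp only [leafDensity]
    linear_combination poissonTransform (childLeaves μ Ξ b j) (exp s) * this
  rw [e]
  refine (abs_add_le _ _).trans ?_
  rw [abs_mul, abs_mul, abs_of_nonneg h2, abs_of_nonneg (exp_pos (-t)).le,
    abs_of_nonneg (sub_nonneg.2 h4), abs_of_nonpos (sub_nonpos.2 h)]
  rw [abs_of_nonpos (sub_nonpos.2 h6)] at h1
  have h7 : leafDensity μ Ξ b j s * (1 - exp (s - t)) ≤ 1 - exp (s - t) :=
    mul_le_of_le_one_left (sub_nonneg.2 h4) h3
  have h8 := mul_le_mul_of_nonneg_left h1 (exp_pos (-t)).le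
  have h9 : exp (-t) * (3 * -(exp s - exp t)) = 3 * (1 - exp (s - t)) := by
    have e1 : exp (-t) * exp t = 1 := by rw [← exp_add, neg_add_cancel, exp_zero]
    have e2 : exp (-t) * exp s = exp (s - t) := by rw [← exp_add]; ring_nf
    linear_combination 3 * e1 - 3 * e2
  linarith

theorem IsBernoulliStrings.tendsto_expectedLeaves_sub (hΞ : IsBernoulliStrings μ p Ξ)
    (hj : 1 ≤ j) (hjb : j ≤ b) :
    Tendsto (fun n : ℕ => expectedLeaves μ Ξ b j n / n - leafDensity μ Ξ b j (log n)) atTop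
      (𝓝 0) := by
  refine (tendsto_poissonTransform_nat_sub_div (hΞ.abs_childLeaves_le hj hjb)
    (hΞ.abs_childLeaves_succ_sub_le hj hjb)).congr' ?_
  filter_upwards [eventually_gt_atTop b] with n hn
  have hn' : (0 : ℝ) < n := by exact_mod_cast (by omega : 0 < n)
  rw [leafDensity_log hn', childLeaves_of_lt hjb hn]

theorem IsPoissonNumber.tendsto_expectedLeavesRandom_sub {N : ℝ≥0 → Ω → ℕ}
    (hN : IsPoissonNumber μ Ξ N) (hΞ : IsBernoulliStrings μ p Ξ) (hj : 1 ≤ j) (hjb : j ≤ b) :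
    Tendsto (fun l : ℝ≥0 => expectedLeavesRandom μ Ξ b j (N l) / l -
      leafDensity μ Ξ b j (log l)) atTop (𝓝 0) := by
  have h1 : Tendsto (fun l : ℝ≥0 => (l : ℝ)⁻¹) atTop (𝓝 0) :=
    tendsto_inv_atTop_zero.comp (NNReal.tendsto_coe_atTop.2 tendsto_id)
  refine squeeze_zero_norm' ?_ h1
  filter_upwards [eventually_gt_atTop 0] with l hl
  have hl' : (0 : ℝ) < l := by exact_mod_cast hl
  rw [leafDensity_log hl', hN.expectedLeavesRandom_eq_add hΞ hj hjb, ← sub_div,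
    add_sub_cancel_right, norm_div, Real.norm_of_nonneg (poissonProb_nonneg hl'.le j),
    Real.norm_of_nonneg hl'.le, div_eq_mul_inv]
  exact mul_le_of_le_one_left (by positivity) (poissonProb_le_one hl'.le j)

/-- Both models have the asymptotics of `leafDensity`. -/
theorem IsBernoulliStrings.tendsto_models {ψ : ℝ → ℝ} (hΞ : IsBernoulliStrings μ p Ξ)
    (hj : 1 ≤ j) (hjb : j ≤ b)
    (h : Tendsto (fun t => leafDensity μ Ξ b j t - ψ t) atTop (𝓝 0)) :
    Tendsto (fun n : ℕ => expectedLeaves μ Ξ b j n / n - ψ (log n)) atTop (𝓝 0) ∧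
      ∀ N : ℝ≥0 → Ω → ℕ, IsPoissonNumber μ Ξ N →
        Tendsto (fun l : ℝ≥0 => expectedLeavesRandom μ Ξ b j (N l) / l - ψ (log l)) atTop
          (𝓝 0) := by
  constructor
  · simpa using (hΞ.tendsto_expectedLeaves_sub hj hjb).add
      (h.comp (tendsto_log_atTop.comp tendsto_natCast_atTop_atTop))
  · intro N hN
    simpa using (hN.tendsto_expectedLeavesRandom_sub hΞ hj hjb).add
      (h.comp (tendsto_log_atTop.comp (NNReal.tendsto_coe_atTop.2 tendsto_id)))

end

theorem mainTheorem9 {Ω : Type*} [MeasurableSpace Ω] (μ : Measure Ω) [IsProbabilityMeasure μ]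
    (p q : ℝ) (hp : 0 < p) (hq : 0 < q) (hpq : p + q = 1) (b : ℕ) (hb : 1 ≤ b)
    (Ξ : ℕ → Ω → ℕ → Bool) (hΞ : IsBernoulliStrings μ p Ξ) :
    -- the formulas for `c_j` and `ĝ_j`
    (∀ j ∈ Finset.Icc 1 b,
      Integrable (gLeaf p q b j) ∧
      cLeaf p q b j = ∫ x in Set.Ioi (0 : ℝ), fLeaf p q b j x / x ^ 2 ∧
      (j = 1 → cLeaf p q b j =
        p * log (1 / p) + q * log (1 / q) -
          ∑ k ∈ Finset.Icc 1 (b - 1), 1 / (k : ℝ) * (p * q ^ k + q * p ^ k)) ∧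
      (2 ≤ j → cLeaf p q b j =
        1 / ((j : ℝ) * ((j : ℝ) - 1)) - ∑ k ∈ Finset.range (b - j + 1), cTerm p q j k) ∧
      HasSum (fun m : ℕ => cTerm p q j (b - j + 1 + m)) (cLeaf p q b j) ∧
      (∀ s : ℝ, ¬ (j = 1 ∧ s = 0) →
        gHatLeaf p q b j s =
            ∫ x in Set.Ioi (0 : ℝ), (fLeaf p q b j x : ℂ) * (x : ℂ) ^ (-2 + Complex.I * s) ∧
        gHatLeaf p q b j s = gHatGamma p q b j s)) ∧
    -- the irrational case
    (Irrational (log p / log q) → ∀ j ∈ Finset.Icc 1 b,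
      Tendsto (fun n : ℕ => expectedLeaves μ Ξ b j n / n) atTop
        (𝓝 (cLeaf p q b j / letterEntropy p q)) ∧
      ∀ N : ℝ≥0 → Ω → ℕ, IsPoissonNumber μ Ξ N →
        Tendsto (fun l : ℝ≥0 => expectedLeavesRandom μ Ξ b j (N l) / l) atTop
          (𝓝 (cLeaf p q b j / letterEntropy p q))) ∧
    -- the rational case
    (¬ Irrational (log p / log q) →
      ∃ d : ℝ, IsGreatest (commonLogDivisors p q) d ∧ ∀ j ∈ Finset.Icc 1 b,
        ∃ ψ : ℝ → ℝ, Continuous ψ ∧ Function.Periodic ψ d ∧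
          (1 / d) * (∫ t in (0 : ℝ)..d, ψ t) = cLeaf p q b j / letterEntropy p q ∧
          (∀ t : ℝ, HasSum
            (fun k : ℤ => (letterEntropy p q : ℂ)⁻¹ * gHatLeaf p q b j (-2 * π * k / d) *
              Complex.exp (2 * π * Complex.I * k * t / d)) (ψ t : ℂ)) ∧
          Tendsto (fun n : ℕ => expectedLeaves μ Ξ b j n / n - ψ (log n)) atTop (𝓝 0) ∧
          ∀ N : ℝ≥0 → Ω → ℕ, IsPoissonNumber μ Ξ N →
            Tendsto (fun l : ℝ≥0 => expectedLeavesRandom μ Ξ b j (N l) / l - ψ (log l)) atTop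
              (𝓝 0)) := by
  have hA : 0 < -log p := neg_pos.2 (log_neg hp (by linarith))
  have hB : 0 < -log q := neg_pos.2 (log_neg hq (by linarith))
  have hH : p * -log p + q * -log q = letterEntropy p q := by rw [letterEntropy]; ring
  refine ⟨fun j hj => ?_, fun hirr j hj => ?_, fun hrat => ?_⟩
  · obtain ⟨hj, hjb⟩ := Finset.mem_Icc.1 hj
    refine ⟨integrable_gLeaf hp hq hpq hj, cLeaf_eq_integral, ?_,
      fun h => cLeaf_eq_of_two_le hp hq hpq h, hasSum_cTerm hp hq hpq hj hjb,
      fun s hs => ⟨gHatLeaf_eq_integral s, gHatLeaf_eq_gHatGamma hp hq hpq hj hs⟩⟩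
    rintro rfl
    exact cLeaf_one hp hq hpq
  · obtain ⟨hj, hjb⟩ := Finset.mem_Icc.1 hj
    have h := (hΞ.renewalSolution hp hq hpq hj hjb).tendsto_of_irrational hA hB
      (by rwa [neg_div_neg_eq]) (hΞ.abs_leafDensity_sub_le hj hjb)
      (integrable_gLeaf hp hq hpq hj).comp_neg
    -- The source is the reflection of g_j, with the same integral c_j, and the mean step is the
    -- entropy H.
    rw [integral_neg_eq_self (gLeaf p q b j), hH] at h
    obtain ⟨h1, h2⟩ := hΞ.tendsto_models (ψ := fun _ => cLeaf p q b j / letterEntropy p q) hj hjb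
      (by simpa [cLeaf] using h.sub_const (cLeaf p q b j / letterEntropy p q))
    exact ⟨by simpa using h1.add_const (cLeaf p q b j / letterEntropy p q),
      fun N hN => by simpa using (h2 N hN).add_const (cLeaf p q b j / letterEntropy p q)⟩
  · obtain ⟨d, m, l, hgr, hd, hm, hl, hmd, hld, hml⟩ :=
      exists_isGreatest_commonLogDivisors hp hq hpq hrat
    refine ⟨d, hgr, fun j hj => ?_⟩
    obtain ⟨hj, hjb⟩ := Finset.mem_Icc.1 hj
    refine ⟨leafPeriodic p q b j d, continuous_leafPeriodic hp hq hpq hj hd,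
      leafPeriodic_periodic d, integral_leafPeriodic hp hq hpq hj hd,
      hasSum_leafPeriodic hp hq hpq hj hd, ?_⟩
    have h := (hΞ.renewalSolution hp hq hpq hj hjb).tendsto_of_lattice hd hm hl hmd hld hml
      (C := 2) (fun t => by
        have := abs_gLeaf_le (b := b) hp hq hpq hj (-t)
        rwa [abs_neg] at this)
    rw [hH] at h
    exact hΞ.tendsto_models hj hjb h
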